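/- Let $G$ be a finite-dimensional Lie group with Lie algebra $\mathfrak g$, and let $L:TG\to\mathbb R$ be a smooth Lagrangian whose Legendre transform $\mathbb FL:TG\to T^*G$, $(g,v)\mapsto(g,\frac{\partial L}{\partial v}(g,v))$, is a diffeomorphism. Write $\ell(g,\xi)=L(g,g\xi)$ for the left-trivialized Lagrangian on $G\times\mathfrak g$, and let $$\mathcal I_{HP}=\{(g,v,p)\in TG\oplus T^*G : p=\tfrac{\partial L}{\partial v}(g,v)\},\qquad \mathcal I_{hp}=\{(g,\xi,\mu)\in G\times\mathfrak g\times\mathfrak g^* : \mu=\tfrac{\partial \ell}{\partial\xi}(g,\xi)\}.$$ Let $\pi_{\mathcal I_{HP}}:\mathcal I_{HP}\to T^*G$ be the restriction of $(g,v,p)\mapsto(g,p)$, let $\phi_{\mathcal I_{hp}}:\mathcal I_{hp}\to\mathcal I_{HP}$ be the restriction of the left trivialization $(g,\xi,\mu)\mapsto(g,g\xi,g\mu)$, where $\langle g\mu,v\rangle=\langle\mu,g^{-1}v\rangle$, let $\Omega=\mathbf d\Theta$ be the canonical symplectic form of $T^*G$ ($\Theta$ the canonical one-form), and set $$\omega_{\mathcal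 I_{hp}}=\phi_{\mathcal I_{hp}}^*\,\pi_{\mathcal I_{HP}}^*\,\Omega .$$ For $a\le b$ let $D\subseteq\mathcal I_{hp}$ be the set of initial conditions $(g(a),\xi(a),\mu(a))$ for which the left-trivialized Hamilton--Pontryagin equations $$\dot g=g\xi,\qquad \dot\mu=\operatorname{ad}^*_\xi\mu+g\,\frac{\partial\ell}{\partial g}(g,\xi),\qquad \mu=\frac{\partial\ell}{\partial\xi}(g,\xi)$$ have a solution on all of $[a,b]$, where $\langle\operatorname{ad}^*_\xi\mu,\eta\rangle=\langle\mu,[\xi,\eta]\rangle$ and $\langle g\frac{\partial\ell}{\partial g},\eta\rangle=\langle\frac{\partial\ell}{\partial g},g\eta\rangle$. Then the end point $(g(b),\xi(b),\mu(b))$ of such a solution is determined by its initial point, so that the left-trivialized HP flow map $F_{hp}:D\to\mathcal I_{hp}$, $(g(a),\xi(a),\mu(a))\mapsto(g(b),\xi(b),\mu(b))$, is well defined; $D$ is open in $\mathcal I_{hp}$, $F_{hp}$ is differentiable on $D$, and $$(F_{hp})^*\,\omega_{\mathcal I_{hp}}=\omega_{\mathcal I_{hp}}\quad\text{on } D .$$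 -/

import Mathlib

open Set Bundle
open scoped Manifold ContDiff

namespace HPFlow
noncomputable section

section Transport
variable {E : Type*} [NormedAddCommGroup E] [NormedSpace ℝ E]
  {H : Type*} [TopologicalSpace H] {I : ModelWithCorners ℝ E H}
  {X M : Type*} [TopologicalSpace X] [TopologicalSpace M] [ChartedSpace H M]

/-- The charts of `M` transported to `X` along a homeomorphism `X ≃ₜ M`. -/
@[reducible] def transportedCharts (e : X ≃ₜ M) : ChartedSpace H X where
  atlas := {c | ∃ c' ∈ atlas H M, c = e.transOpenPartialHomeomorph c'}
  chartAt x := e.transOpenPartialHomeomorph (chartAt H (e x))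
  mem_chart_source x := by simp
  chart_mem_atlas x := ⟨_, chart_mem_atlas H (e x), rfl⟩

theorem transportedCharts_isManifold [IsManifold I ∞ M] (e : X ≃ₜ M) :
    @IsManifold ℝ _ E _ _ H _ I ∞ X _ (transportedCharts e) := by
  let _ : ChartedSpace H X := transportedCharts e
  refine isManifold_of_contDiffOn I ∞ X ?_
  rintro _ _ ⟨c, hc, rfl⟩ ⟨c', hc', rfl⟩
  have h := ((mem_groupoid_of_pregroupoid).1
    ((contDiffGroupoid ∞ I).compatible hc hc')).1
  simp only [contDiffPregroupoid] at h
  convert! h using 1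
  · ext y; simp
  · ext y; simp

theorem contMDiff_transported (e : X ≃ₜ M) :
    @ContMDiff ℝ _ E _ _ H _ I X _ (transportedCharts e) E _ _ H _ I M _ _ ∞ e := by
  let _ : ChartedSpace H X := transportedCharts e
  intro x
  rw [contMDiffAt_iff]
  refine ⟨e.continuous.continuousAt, ?_⟩
  convert! (contMDiffAt_iff.1 (contMDiffAt_id (I := I) (n := ∞) (x := e x))).2 using 1
  ext y
  change I (chartAt H (e x) (e (e.symm ((chartAt H (e x)).symm (I.symm y))))) =
    I (chartAt H (e x) ((chartAt H (e x)).symm (I.symm y)))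
  rw [e.apply_symm_apply]

theorem contMDiff_transported_symm (e : X ≃ₜ M)  :
    @ContMDiff ℝ _ E _ _ H _ I M _ _ E _ _ H _ I X _ (transportedCharts e) ∞ e.symm := by
  let _ : ChartedSpace H X := transportedCharts e
  intro x
  rw [contMDiffAt_iff]
  refine ⟨e.symm.continuous.continuousAt, ?_⟩
  convert! (contMDiffAt_iff.1 (contMDiffAt_id (I := I) (n := ∞) (x := x))).2 using 1
  ext y
  change I (chartAt H (e (e.symm x)) (e (e.symm ((chartAt H x).symm (I.symm y))))) =
    I (chartAt H x ((chartAt H x).symm (I.symm y)))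
  rw [e.apply_symm_apply, e.apply_symm_apply]

end Transport

section Forms
variable {E : Type*} [NormedAddCommGroup E] [NormedSpace ℝ E]
  {H : Type*} [TopologicalSpace H] (I : ModelWithCorners ℝ E H)
  {E' : Type*} [NormedAddCommGroup E'] [NormedSpace ℝ E']
  {H' : Type*} [TopologicalSpace H'] (I' : ModelWithCorners ℝ E' H')
  (M : Type*) [TopologicalSpace M] [ChartedSpace H M]
  {N : Type*} [TopologicalSpace N] [ChartedSpace H' N] {k : ℕ}

/-- Differential `k`-forms on a manifold, as families of alternating forms on the tangent spaces. -/
abbrev DiffForm (k : ℕ) : Type _ := ∀ x : M, TangentSpace I x [⋀^Fin k]→L[ℝ] ℝ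

variable {M}

/-- The pullback `f^* α` of a differential form. -/
def formPullback (f : M → N) (α : DiffForm I' N k) : DiffForm I M k :=
  fun x => (α (f x)).compContinuousLinearMap (mfderiv I I' f x)

/-- The exterior derivative of a differential form on a manifold, computed at `x` in the preferred
chart at `x`: pull the form back to the model space, differentiate there, and pull back to `M`. -/
def exteriorDerivative (α : DiffForm I M k) : DiffForm I M (k + 1) := fun x =>
  (extDerivWithin
    (fun y : E => ((α ((extChartAt I x).symm y)).compContinuousLinearMap
      (mfderivWithin 𝓘(ℝ, E) I (extChartAt I x).symm (range I) y) : E [⋀^Fin k]→L[ℝ] ℝ))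
    (range I) (extChartAt I x x)).compContinuousLinearMap
      (mfderiv I 𝓘(ℝ, E) (extChartAt I x) x)

end Forms

section
variable {E : Type*} [NormedAddCommGroup E] [NormedSpace ℝ E]
  {H : Type*} [TopologicalSpace H] {I : ModelWithCorners ℝ E H}
  {G : Type*} [TopologicalSpace G] [ChartedSpace H G]
variable (I G) in
/-- The cotangent bundle `T*G`. -/
abbrev CotangentBundle : Type _ := TotalSpace (E →L[ℝ] ℝ) (fun g : G => TangentSpace I g →L[ℝ] ℝ)
variable (I G) in
/-- The Whitney sum `TG ⊕ T*G`, with elements `(g, (v, p))`. -/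
abbrev PontryaginBundle : Type _ := TotalSpace (E × (E →L[ℝ] ℝ)) (fun g : G => TangentSpace I g × (TangentSpace I g →L[ℝ] ℝ))

variable (I G) in
/-- Smooth Lagrangians `L : TG → ℝ`. -/
abbrev Lagrangian [IsManifold I ∞ G] : Type _ := C^∞⟮I.tangent, TangentBundle I G; 𝓘(ℝ, ℝ), ℝ⟯

variable [Group G]

variable (I) in
/-- `ξ ↦ g ξ`, the derivative at the identity of left translation by `g`. Here `GroupLieAlgebra I G`
is the tangent space of `G` at the identity, which is by definition the model space `E`. -/
def leftMul (g : G) : GroupLieAlgebra I G →L[ℝ] TangentSpace I g :=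
  mfderiv I I (fun h : G => g * h) 1
variable (I) in
/-- `v ↦ g⁻¹ v`, the derivative at `g` of left translation by `g⁻¹`. -/
def leftMulInv (g : G) : TangentSpace I g →L[ℝ] GroupLieAlgebra I G :=
  mfderiv I I (fun h : G => g⁻¹ * h) g

variable [LieGroup I ∞ G]

theorem leftMul_leftMulInv (g : G) (v : TangentSpace I g) :
    leftMul I g (leftMulInv I g v) = v := by
  have h1 : MDifferentiableAt I I (fun h : G => g⁻¹ * h) g :=
    (contMDiff_mul_left (n := ∞)).mdifferentiableAt (by simp)
  have h2 : MDifferentiableAt I I (fun h : G => g * h) (g⁻¹ * g) :=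
    (contMDiff_mul_left (n := ∞)).mdifferentiableAt (by simp)
  have h3 := mfderiv_comp g h2 h1
  have h4 : (fun h : G => g * h) ∘ (fun h : G => g⁻¹ * h) = id := by ext; simp
  rw [h4, mfderiv_id] at h3
  have h5 := congrArg (fun f : E →L[ℝ] E => f v) h3
  have key : ∀ x : G, x = 1 → ∀ w : E,
    (mfderiv I I (fun h : G => g * h) x : E →L[ℝ] E) w = (mfderiv I I (fun h : G => g * h) 1 : E →L[ℝ] E) w := by
    rintro x rfl w; rfl
  exact (key (g⁻¹ * g) (by simp) _).symm.trans (Eq.symm h5)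

theorem leftMulInv_leftMul (g : G) (v : GroupLieAlgebra I G) :
    leftMulInv I g (leftMul I g v) = v := by
  have h1 : MDifferentiableAt I I (fun h : G => g⁻¹ * h) (g * 1) :=
    (contMDiff_mul_left (n := ∞)).mdifferentiableAt (by simp)
  have h2 : MDifferentiableAt I I (fun h : G => g * h) 1 :=
    (contMDiff_mul_left (n := ∞)).mdifferentiableAt (by simp)
  have h3 := mfderiv_comp 1 h1 h2
  have h4 : (fun h : G => g⁻¹ * h) ∘ (fun h : G => g * h) = id := by ext; simp
  rw [h4, mfderiv_id] at h3
  have h5 := congrArg (fun f : E →L[ℝ] E => f v) h3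
  have key : ∀ x : G, x = g → ∀ w : E,
    (mfderiv I I (fun h : G => g⁻¹ * h) x : E →L[ℝ] E) w = (mfderiv I I (fun h : G => g⁻¹ * h) g : E →L[ℝ] E) w := by
    rintro x rfl w; rfl
  exact (key (g * 1) (by simp) _).symm.trans (Eq.symm h5)

theorem trivializationAt_self_snd (g : G) (v : E) :
    (trivializationAt E (TangentSpace I) g (⟨g, v⟩ : TangentBundle I G)).2 = v :=
  (tangentBundleCore I G).coordChange_self (achart H g) g (mem_chart_source H g) v

theorem contMDiff_leftMul : ContMDiff (I.prod 𝓘(ℝ, E)) I.tangent ∞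
    (fun p : G × E => (⟨p.1, leftMul I p.1 p.2⟩ : TangentBundle I G)) := by
  intro p₀
  have hϕ := ContMDiffAt.mfderiv (I := I) (I' := I)
    (J := I.prod 𝓘(ℝ, E)) (m := ∞) (n := ∞) (x₀ := p₀)
    (fun (p : G × E) (h : G) => p.1 * h) (fun _ => 1)
    ((contMDiff_fst.fst.mul contMDiff_snd).contMDiffAt) contMDiffAt_const (by simp)
  have e : (fun p : G × E => p.1 * 1) = fun p => p.1 := by ext; simp
  rw [e] at hϕ
  refine ContMDiffAt.clm_apply_of_inCoordinates (M := G × E) (IM := I.prod 𝓘(ℝ, E)) (b₁ := fun _ : G × E => (1 : G)) (b₂ := fun p => p.1)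
    (ϕ := fun p => leftMul I p.1) (v := fun p => p.2) (IB₁ := I) hϕ ?_ contMDiffAt_fst
  rw [contMDiffAt_totalSpace]
  refine ⟨contMDiffAt_const, ?_⟩
  convert! (contMDiffAt_snd : ContMDiffAt (I.prod 𝓘(ℝ, E)) 𝓘(ℝ, E) ∞ _ p₀) using 1
  ext p
  exact trivializationAt_self_snd 1 p.2

theorem contMDiff_leftMulInv : ContMDiff I.tangent (I.prod 𝓘(ℝ, E)) ∞
    (fun x : TangentBundle I G => ((x.1, leftMulInv I x.1 x.2) : G × E)) := by
  intro p₀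
  have hϕ := ContMDiffAt.mfderiv (I := I) (I' := I)
    (J := I.tangent) (m := ∞) (n := ∞) (x₀ := p₀)
    (fun (p : TangentBundle I G) (h : G) => p.1⁻¹ * h) (fun p => p.1)
    ((((contMDiff_proj (TangentSpace I)).comp contMDiff_fst).inv.mul contMDiff_snd).contMDiffAt) (contMDiffAt_proj (TangentSpace I)) (by simp)
  have e : (fun p : TangentBundle I G => p.1⁻¹ * p.1) = fun p => 1 := by ext; simp
  rw [e] at hϕ
  have := ContMDiffAt.clm_apply_of_inCoordinates (b₂ := fun _ : TangentBundle I G => (1 : G)) (b₁ := fun p => p.1)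
    (ϕ := fun p => leftMulInv I p.1) (v := fun p => p.2) (IB₂ := I) hϕ contMDiffAt_id contMDiffAt_const
  rw [contMDiffAt_totalSpace] at this
  have h2 : ContMDiffAt I.tangent 𝓘(ℝ, E) ∞
      (fun x : TangentBundle I G => (show E from leftMulInv I x.1 x.2)) p₀ := by
    convert! this.2 using 1
    ext p
    exact (trivializationAt_self_snd 1 _).symm
  exact ContMDiffAt.prodMk (N' := E) (contMDiffAt_proj (TangentSpace I)) h2

theorem contMDiff_coMul : ContMDiff (I.prod 𝓘(ℝ, E →L[ℝ] ℝ)) (I.prod 𝓘(ℝ, E →L[ℝ] ℝ)) ∞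
    (fun p : G × (E →L[ℝ] ℝ) => (⟨p.1, ContinuousLinearMap.comp p.2 (leftMulInv I p.1)⟩ : CotangentBundle I G)) := by
  intro p₀
  have hϕ := ContMDiffAt.mfderiv (I := I) (I' := I)
    (J := I.prod 𝓘(ℝ, E →L[ℝ] ℝ)) (m := ∞) (n := ∞) (x₀ := p₀)
    (fun (p : G × (E →L[ℝ] ℝ)) (h : G) => p.1⁻¹ * h) (fun p => p.1)
    ((contMDiff_fst.fst.inv.mul contMDiff_snd).contMDiffAt) contMDiffAt_fst (by simp)
  have e : (fun p : G × (E →L[ℝ] ℝ) => p.1⁻¹ * p.1) = fun p => 1 := by ext; simp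
  rw [e] at hϕ
  rw [contMDiffAt_hom_bundle]
  refine ⟨contMDiffAt_fst, ?_⟩
  convert! ContMDiffAt.clm_comp (contMDiffAt_snd (n := ∞)) hϕ using 1
  ext p w
  simp only [inTangentCoordinates, ContinuousLinearMap.inCoordinates]
  simp only [ContinuousLinearMap.comp_apply]
  rw [Trivialization.continuousLinearMapAt_apply, Trivialization.continuousLinearMapAt_apply, Trivialization.coe_linearMapAt_of_mem, Trivialization.coe_linearMapAt_of_mem]
  · exact congrArg p.2 (trivializationAt_self_snd 1 _).symm
  · exact mem_baseSet_trivializationAt E (TangentSpace I) 1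
  · trivial

/-- The left trivialization `φ : G × 𝔤 × 𝔤* → TG ⊕ T*G`, `(g, ξ, μ) ↦ (g, g ξ, g μ)`, where
`⟨g μ, v⟩ = ⟨μ, g⁻¹ v⟩`. The Lie algebra `𝔤 = T_1 G` is written as the model space `E`, which
carries its manifold structure. -/
def leftTrivialization (x : G × E × (E →L[ℝ] ℝ)) : PontryaginBundle I G :=
  ⟨x.1, (leftMul I x.1 x.2.1, ContinuousLinearMap.comp x.2.2 (leftMulInv I x.1))⟩

variable (L : Lagrangian I G)

/-- `∂L/∂v (g, v)`, the derivative of `L` along the fibre `T_g G`. -/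
def fiberDerivative (x : TangentBundle I G) : TangentSpace I x.1 →L[ℝ] ℝ :=
  fderiv ℝ (fun w : E => L ⟨x.1, w⟩) x.2

/-- The Legendre transform `FL : TG → T*G`, `(g, v) ↦ (g, ∂L/∂v (g, v))`. -/
def legendreTransform (x : TangentBundle I G) : CotangentBundle I G :=
  ⟨x.1, fiberDerivative L x⟩

/-- The Legendre transform is invertible: it is a diffeomorphism from `TG` onto `T*G`. -/
def Hyperregular : Prop :=
  ∃ Φ : Diffeomorph I.tangent (I.prod 𝓘(ℝ, E →L[ℝ] ℝ)) (TangentBundle I G)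
    (CotangentBundle I G) ∞, ∀ x, Φ x = legendreTransform L x

/-- The left-trivialized Lagrangian `ℓ(g, ξ) = L(g, g ξ)`. -/
def leftLagrangian (g : G) (ξ : E) : ℝ := L ⟨g, leftMul I g ξ⟩

/-- `∂ℓ/∂ξ (g, ξ)`, an element of `𝔤*`. -/
def dLagrangian_dξ (g : G) (ξ : E) : E →L[ℝ] ℝ := fderiv ℝ (fun ζ : E => leftLagrangian L g ζ) ξ

/-- `∂ℓ/∂g (g, ξ)`, an element of `T*_g G`: the derivative of `h ↦ ℓ(h, ξ)` at `g`. -/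
def dLagrangian_dg (g : G) (ξ : E) : TangentSpace I g →L[ℝ] ℝ :=
  mfderiv I 𝓘(ℝ, ℝ) (fun h : G => leftLagrangian L h ξ) g

theorem contMDiff_leftLagrangian : ContMDiff (I.prod 𝓘(ℝ, E)) 𝓘(ℝ, ℝ) ∞
    (fun p : G × E => leftLagrangian L p.1 p.2) :=
  L.contMDiff.comp contMDiff_leftMul

theorem contMDiff_dLagrangian_dξ : ContMDiff (I.prod 𝓘(ℝ, E)) 𝓘(ℝ, E →L[ℝ] ℝ) ∞
    (fun p : G × E => dLagrangian_dξ L p.1 p.2) := by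
  intro p₀
  have h := ContMDiffAt.mfderiv (I := 𝓘(ℝ, E)) (I' := 𝓘(ℝ, ℝ)) (J := I.prod 𝓘(ℝ, E))
    (m := ∞) (n := ∞) (x₀ := p₀)
    (fun (p : G × E) (ξ : E) => leftLagrangian L p.1 ξ) (fun p => p.2)
    (((contMDiff_leftLagrangian L).comp (contMDiff_fst.fst.prodMk contMDiff_snd)).contMDiffAt)
    contMDiffAt_snd (by simp)
  have e := inTangentCoordinates_model_space (I := 𝓘(ℝ, E)) (I' := 𝓘(ℝ, ℝ))
    (fun p : G × E => p.2) (fun p => leftLagrangian L p.1 p.2)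
    (fun p => dLagrangian_dξ L p.1 p.2) p₀
  have e' : (fun p : G × E => dLagrangian_dξ L p.1 p.2) =
      fun p : G × E => mfderiv 𝓘(ℝ, E) 𝓘(ℝ, ℝ) (fun ξ : E => leftLagrangian L p.1 ξ) p.2 := by
    funext p
    exact (mfderiv_eq_fderiv (𝕜 := ℝ) (E := E) (E' := ℝ)
      (f := fun ξ : E => leftLagrangian L p.1 ξ) (x := p.2)).symm
  rw [← e, e']
  exact h

theorem fiberDerivative_eq (g : G) (ξ : E) :
    fiberDerivative L ⟨g, leftMul I g ξ⟩ =
      ContinuousLinearMap.comp (dLagrangian_dξ L g ξ) (leftMulInv I g) := by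
  let A : E ≃L[ℝ] E := ContinuousLinearEquiv.equivOfInverse (M₁ := E) (M₂ := E)
    (leftMul I g) (leftMulInv I g) (leftMulInv_leftMul g) (leftMul_leftMulInv g)
  have h := A.comp_right_fderiv (f := fun w : E => L ⟨g, w⟩) (x := ξ)
  have h' : dLagrangian_dξ L g ξ = (fiberDerivative L ⟨g, leftMul I g ξ⟩ : E →L[ℝ] ℝ).comp (A : E →L[ℝ] E) := h
  rw [h']
  refine ContinuousLinearMap.ext fun v => ?_
  exact congrArg (fiberDerivative L ⟨g, leftMul I g ξ⟩) (leftMul_leftMulInv g v).symm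

theorem contMDiff_leftTrivialization :
    ContMDiff (I.prod (𝓘(ℝ, E).prod 𝓘(ℝ, E →L[ℝ] ℝ))) (I.prod 𝓘(ℝ, E × (E →L[ℝ] ℝ))) ∞
      (leftTrivialization (I := I) (G := G)) := by
  intro p₀
  have h1 := (contMDiff_leftMul (I := I) (G := G)).comp
    (contMDiff_fst.prodMk contMDiff_snd.fst :
      ContMDiff (I.prod (𝓘(ℝ, E).prod 𝓘(ℝ, E →L[ℝ] ℝ))) _ ∞ (fun p : G × E × (E →L[ℝ] ℝ) => (p.1, p.2.1))) p₀
  have h2 := (contMDiff_coMul (I := I) (G := G)).comp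
    (contMDiff_fst.prodMk contMDiff_snd.snd :
      ContMDiff (I.prod (𝓘(ℝ, E).prod 𝓘(ℝ, E →L[ℝ] ℝ))) _ ∞ (fun p : G × E × (E →L[ℝ] ℝ) => (p.1, p.2.2))) p₀
  rw [contMDiffAt_totalSpace] at h1 h2 ⊢
  exact ⟨h1.1, h1.2.prodMk_space h2.2⟩

/-- The natural projection `TG ⊕ T*G → T*G`, `(g, v, p) ↦ (g, p)`. -/
def piHP (x : PontryaginBundle I G) : CotangentBundle I G := ⟨x.1, x.2.2⟩

/-- The projection `TG ⊕ T*G → TG`, `(g, v, p) ↦ (g, v)`. -/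
def piT (x : PontryaginBundle I G) : TangentBundle I G := ⟨x.1, x.2.1⟩

theorem contMDiff_piHP : ContMDiff (I.prod 𝓘(ℝ, E × (E →L[ℝ] ℝ))) (I.prod 𝓘(ℝ, E →L[ℝ] ℝ)) ∞
    (piHP (I := I) (G := G)) := by
  intro p₀
  have h := contMDiffAt_id (I := I.prod 𝓘(ℝ, E × (E →L[ℝ] ℝ))) (n := ∞) (x := p₀)
  rw [contMDiffAt_totalSpace] at h ⊢
  have h' := ContMDiffAt.comp p₀
    (g := (Prod.snd : E × (E →L[ℝ] ℝ) → E →L[ℝ] ℝ)) contDiff_snd.contMDiff.contMDiffAt h.2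
  exact ⟨h.1, h'⟩

theorem contMDiff_piT : ContMDiff (I.prod 𝓘(ℝ, E × (E →L[ℝ] ℝ))) I.tangent ∞
    (piT (I := I) (G := G)) := by
  intro p₀
  have h := contMDiffAt_id (I := I.prod 𝓘(ℝ, E × (E →L[ℝ] ℝ))) (n := ∞) (x := p₀)
  rw [contMDiffAt_totalSpace] at h ⊢
  have h' := ContMDiffAt.comp p₀
    (g := (Prod.fst : E × (E →L[ℝ] ℝ) → E)) contDiff_fst.contMDiff.contMDiffAt h.2
  exact ⟨h.1, h'⟩

/-- The admissible space `{(g, v, p) ∈ TG ⊕ T*G | p = ∂L/∂v (g, v)}`. -/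
def admissibleHP : Set (PontryaginBundle I G) :=
  {x | x.2.2 = fiberDerivative L ⟨x.1, x.2.1⟩}

/-- The left-trivialized admissible space `{(g, ξ, μ) ∈ G × 𝔤 × 𝔤* | μ = ∂ℓ/∂ξ (g, ξ)}`. -/
def admissibleLeft : Set (G × E × (E →L[ℝ] ℝ)) :=
  {x | x.2.2 = dLagrangian_dξ L x.1 x.2.1}

/-- The left-trivialized admissible space is the graph of the smooth map `∂ℓ/∂ξ` over `G × 𝔤`; its
manifold structure is the one of this graph. -/
def admissibleLeftHomeo : admissibleLeft L ≃ₜ G × E where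
  toFun x := (x.1.1, x.1.2.1)
  invFun p := ⟨(p.1, p.2, dLagrangian_dξ L p.1 p.2), rfl⟩
  left_inv := by
    rintro ⟨⟨g, ξ, μ⟩, h⟩
    have h' : μ = dLagrangian_dξ L g ξ := h
    subst h'
    rfl
  right_inv _ := rfl
  continuous_toFun := by fun_prop
  continuous_invFun := Continuous.subtype_mk (continuous_fst.prodMk
    (continuous_snd.prodMk (contMDiff_dLagrangian_dξ L).continuous)) _

instance : ChartedSpace (ModelProd H E) (admissibleLeft L) :=
  transportedCharts (admissibleLeftHomeo L)

instance : IsManifold (I.prod 𝓘(ℝ, E)) ∞ (admissibleLeft L) :=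
  transportedCharts_isManifold (admissibleLeftHomeo L)

/-- `(g, v) ↦ (g, v, ∂L/∂v (g, v))`. -/
def legendreGraph (x : TangentBundle I G) : PontryaginBundle I G := ⟨x.1, (x.2, fiberDerivative L x)⟩

theorem contMDiff_legendreGraph :
    ContMDiff I.tangent (I.prod 𝓘(ℝ, E × (E →L[ℝ] ℝ))) ∞ (legendreGraph L) := by
  have h := contMDiff_leftTrivialization.comp ((contMDiff_fst.prodMk
    (contMDiff_snd.prodMk (contMDiff_dLagrangian_dξ L))).comp
      (contMDiff_leftMulInv (I := I) (G := G)))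
  convert! h using 1
  funext x
  obtain ⟨g, v⟩ := x
  have h1 := fiberDerivative_eq L g (leftMulInv I g v)
  rw [leftMul_leftMulInv] at h1
  simp only [legendreGraph, leftTrivialization, Function.comp]
  rw [h1, leftMul_leftMulInv]

/-- The admissible space in `TG ⊕ T*G` is a smooth graph over `TG`; its manifold structure is the one
of this graph. -/
def admissibleHPHomeo : admissibleHP L ≃ₜ TangentBundle I G where
  toFun x := piT x.1
  invFun x := ⟨legendreGraph L x, rfl⟩
  left_inv := by
    rintro ⟨⟨g, v, p⟩, h⟩
    have h' : p = fiberDerivative L ⟨g, v⟩ := h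
    subst h'
    rfl
  right_inv _ := rfl
  continuous_toFun := contMDiff_piT.continuous.comp continuous_subtype_val
  continuous_invFun := Continuous.subtype_mk (contMDiff_legendreGraph L).continuous _

instance : ChartedSpace (ModelProd H E) (admissibleHP L) :=
  transportedCharts (admissibleHPHomeo L)

instance : IsManifold I.tangent ∞ (admissibleHP L) :=
  transportedCharts_isManifold (admissibleHPHomeo L)

theorem contMDiff_admissibleLeft_val :
    ContMDiff (I.prod 𝓘(ℝ, E)) (I.prod (𝓘(ℝ, E).prod 𝓘(ℝ, E →L[ℝ] ℝ))) ∞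
      (Subtype.val : admissibleLeft L → G × E × (E →L[ℝ] ℝ)) := by
  have h := (contMDiff_fst.prodMk (contMDiff_snd.prodMk (contMDiff_dLagrangian_dξ L))).comp
      (contMDiff_transported (admissibleLeftHomeo L))
  convert! h using 1
  funext x
  exact congrArg Subtype.val ((admissibleLeftHomeo L).symm_apply_apply x).symm

theorem contMDiff_admissibleHP_val :
    ContMDiff I.tangent (I.prod 𝓘(ℝ, E × (E →L[ℝ] ℝ))) ∞
      (Subtype.val : admissibleHP L → PontryaginBundle I G) := by
  have h := (contMDiff_legendreGraph L).comp (contMDiff_transported (admissibleHPHomeo L))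
  convert! h using 1
  funext x
  exact congrArg Subtype.val ((admissibleHPHomeo L).symm_apply_apply x).symm

/-- The left trivialization restricted to the admissible spaces. -/
def leftTrivializationRestr (x : admissibleLeft L) : admissibleHP L :=
  ⟨leftTrivialization x.1, by
    obtain ⟨⟨g, ξ, μ⟩, h⟩ := x
    have h' : μ = dLagrangian_dξ L g ξ := h
    subst h'
    exact (fiberDerivative_eq L g ξ).symm⟩

theorem contMDiff_leftTrivializationRestr :
    ContMDiff (I.prod 𝓘(ℝ, E)) I.tangent ∞ (leftTrivializationRestr L) := by
  have h := (contMDiff_transported_symm (I := I.tangent) (admissibleHPHomeo L)).comp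
    (contMDiff_piT.comp
      (contMDiff_leftTrivialization.comp (contMDiff_admissibleLeft_val L)))
  convert! h using 1
  funext x
  exact ((admissibleHPHomeo L).symm_apply_apply (leftTrivializationRestr L x)).symm

/-- The natural projection restricted to the admissible space. -/
def piHPRestr (x : admissibleHP L) : CotangentBundle I G := piHP x.1

variable (I G) in
/-- The canonical one-form `Θ` on `T*G`: `Θ_(g,p) (w) = ⟨p, dπ w⟩` for the projection `π : T*G → G`. -/
def canonicalOneForm : DiffForm (I.prod 𝓘(ℝ, E →L[ℝ] ℝ)) (CotangentBundle I G) 1 := fun x =>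
  ContinuousAlternatingMap.ofSubsingleton ℝ _ ℝ (0 : Fin 1)
    (ContinuousLinearMap.comp x.2 (mfderiv (I.prod 𝓘(ℝ, E →L[ℝ] ℝ)) I
      (TotalSpace.proj : CotangentBundle I G → G) x))

variable (I G) in
/-- The canonical symplectic form `Ω = dΘ` on `T*G`. -/
def canonicalTwoForm : DiffForm (I.prod 𝓘(ℝ, E →L[ℝ] ℝ)) (CotangentBundle I G) 2 :=
  exteriorDerivative (I.prod 𝓘(ℝ, E →L[ℝ] ℝ)) (canonicalOneForm I G)

/-- The symplectic form on the admissible space in `TG ⊕ T*G`: the pullback of `Ω` by the restricted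
projection. -/
def symplecticFormHP : DiffForm I.tangent (admissibleHP L) 2 :=
  formPullback I.tangent (I.prod 𝓘(ℝ, E →L[ℝ] ℝ)) (piHPRestr L) (canonicalTwoForm I G)

/-- The symplectic form on the left-trivialized admissible space: the pullback of the previous form
by the restricted left trivialization. -/
def symplecticFormLeft : DiffForm (I.prod 𝓘(ℝ, E)) (admissibleLeft L) 2 :=
  formPullback (I.prod 𝓘(ℝ, E)) I.tangent (leftTrivializationRestr L) (symplecticFormHP L)

section Flow
variable [FiniteDimensional ℝ E]

/-- The map `ad*_ξ` on `𝔤*`: `⟨ad*_ξ μ, η⟩ = ⟨μ, [ξ, η]⟩`. -/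
def coad (ξ : GroupLieAlgebra I G) (μ : GroupLieAlgebra I G →L[ℝ] ℝ) :
    GroupLieAlgebra I G →L[ℝ] ℝ :=
  haveI : CompleteSpace E := FiniteDimensional.complete ℝ E
  haveI : LieGroup I (minSmoothness ℝ 3) G := by
    rw [minSmoothness_of_isRCLikeNormedField]; infer_instance
  let adξ : E →ₗ[ℝ] E := LieAlgebra.ad ℝ (GroupLieAlgebra I G) ξ
  let ν : E →L[ℝ] ℝ := μ
  ν.comp (LinearMap.toContinuousLinearMap (𝕜 := ℝ) (E := E) (F' := E) adξ)

theorem coad_apply (ξ η : GroupLieAlgebra I G) (μ : GroupLieAlgebra I G →L[ℝ] ℝ) :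
    coad ξ μ η = μ ⁅ξ, η⁆ := rfl

/-- Solutions on `[a, b]` of the left-trivialized HP equations
`ġ = g ξ`, `μ̇ = ad*_ξ μ + g ∂ℓ/∂g (g, ξ)`, `μ = ∂ℓ/∂ξ (g, ξ)`.
The covector `g ∂ℓ/∂g ∈ 𝔤*` is `η ↦ ⟨∂ℓ/∂g, g η⟩`. -/
structure IsHPSolution (a b : ℝ) (g : ℝ → G) (ξ : ℝ → E) (μ : ℝ → E →L[ℝ] ℝ) : Prop where
  reconstruction : ∀ t ∈ Icc a b, HasMFDerivWithinAt 𝓘(ℝ, ℝ) I g (Icc a b) t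
    (ContinuousLinearMap.smulRight (1 : ℝ →L[ℝ] ℝ) (leftMul I (g t) (ξ t)))
  momentum : ∀ t ∈ Icc a b, HasDerivWithinAt μ
    (coad (I := I) (G := G) (ξ t) (μ t) + (dLagrangian_dg L (g t) (ξ t)).comp (leftMul I (g t)))
    (Icc a b) t
  legendre : ∀ t ∈ Icc a b, μ t = dLagrangian_dξ L (g t) (ξ t)

/-- Some solution on `[a, b]` starts at `x` at time `a` and ends at `y` at time `b`. -/
def HPConnects (a b : ℝ) (x y : admissibleLeft L) : Prop :=
  ∃ (g : ℝ → G) (ξ : ℝ → E) (μ : ℝ → E →L[ℝ] ℝ), IsHPSolution L a b g ξ μ ∧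
    (g a, ξ a, μ a) = x.1 ∧ (g b, ξ b, μ b) = y.1

/-- The initial conditions for which the equations have a solution on all of `[a, b]`. -/
def flowDomain (a b : ℝ) : Set (admissibleLeft L) := {x | ∃ y, HPConnects L a b x y}

open Classical in
/-- The left-trivialized HP flow map from time `a` to time `b`: an initial condition is sent to the
end point of the solution that starts there. Off `flowDomain` the value is irrelevant. -/
def flowMap (a b : ℝ) (x : admissibleLeft L) : admissibleLeft L :=
  if h : ∃ y, HPConnects L a b x y then h.choose else x
end Flow

end
end
end HPFlow

open HPFlow

/-!
Hyperregularity solves `μ = ∂ℓ/∂ξ (g, ξ)` for `ξ = X (g, μ)`, so the admissible space is a copy of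
`G × 𝔤*` and the Hamilton–Pontryagin equations become a smooth vector field there. In a chart of
`G`, the canonical one-form is `θ = ⟨μ, σ⟩` with `σ` the left Maurer–Cartan form. By the structure
equation of `σ`, which produces the coadjoint term, the equations give that the Lie derivative of
`θ` along this field is the differential of `(g, μ) ↦ ℓ (g, X (g, μ))`. Hence the Lie derivative of
`dθ` vanishes, so `dθ` is constant along solutions of the linearized equation, and these are the
derivatives of the local flow with respect to the initial point. Finitely many such local flows
cover a solution on `[a, b]`; composing them gives openness, differentiability and invariance at
once.
-/

namespace HPFlow
noncomputable section

open scoped Topology NNReal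

section LocalFlow
open Metric
variable {F F' : Type*} [NormedAddCommGroup F] [NormedSpace ℝ F]
  [NormedAddCommGroup F'] [NormedSpace ℝ F']

theorem hasDerivWithinAt_Ici_of_Icc {f : ℝ → F} {f' : F} {a b t : ℝ}
    (h : HasDerivWithinAt f f' (Icc a b) t) (ht : t ∈ Ico a b) :
    HasDerivWithinAt f f' (Ici t) t :=
  h.mono_of_mem_nhdsWithin (Icc_mem_nhdsGE_of_mem ht)

theorem norm_sub_sub_fderiv_le_of_lipschitzOnWith {f : F → F'} {S : Set F} (hS : Convex ℝ S)
    {K : ℝ≥0} (hd : ∀ y ∈ S, DifferentiableAt ℝ f y) (hlip : LipschitzOnWith K (fderiv ℝ f) S)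
    {y z : F} (hy : y ∈ S) (hz : z ∈ S) :
    ‖f z - f y - fderiv ℝ f y (z - y)‖ ≤ K * ‖z - y‖ ^ 2 := by
  have hseg : segment ℝ y z ⊆ S := hS.segment_subset hy hz
  have hbound : ∀ w ∈ segment ℝ y z, ‖fderiv ℝ f w - fderiv ℝ f y‖ ≤ K * ‖z - y‖ := fun w hw =>
    (hlip.norm_sub_le (hseg hw) hy).trans <| mul_le_mul_of_nonneg_left
      (by simpa [norm_sub_rev] using norm_sub_le_of_mem_segment hw) K.2
  have h := (convex_segment y z).norm_image_sub_le_of_norm_hasFDerivWithin_le'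
    (fun w hw => (hd w (hseg hw)).hasFDerivAt.hasFDerivWithinAt) hbound
    (left_mem_segment ℝ y z) (right_mem_segment ℝ y z)
  rwa [mul_assoc, ← sq] at h

theorem hasFDerivAt_of_norm_sub_sub_le_sq {f : F → F'} {A : F →L[ℝ] F'} {C : ℝ} {y : F}
    (h : ∀ᶠ z in 𝓝 y, ‖f z - f y - A (z - y)‖ ≤ C * ‖z - y‖ ^ 2) : HasFDerivAt f A y := by
  have hO : (fun z => f z - f y - A (z - y)) =O[𝓝 y] fun z => ‖z - y‖ ^ 2 :=
    .of_bound C (by simpa using h)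
  exact .of_isLittleO (hO.trans_isLittleO (Asymptotics.isLittleO_pow_sub_sub y one_lt_two))

theorem gronwallBound_zero_mul (K c ε x : ℝ) :
    gronwallBound 0 K (c * ε) x = c * gronwallBound 0 K ε x := by
  by_cases hK : K = 0
  · simp [gronwallBound, hK, mul_assoc]
  · simp only [gronwallBound, hK, if_false]; ring

/-- The first variation of the vector field `f`: its integral curves `(c, V)` consist of an integral
curve `c` of `f` and a solution `V` of the linearized equation `V' = Df(c) ∘ V` along `c`. -/
def firstVariation (f : F → F) (p : F × (F →L[ℝ] F)) : F × (F →L[ℝ] F) :=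
  (f p.1, (fderiv ℝ f p.1).comp p.2)

theorem hasDerivWithinAt_fst_of_firstVariation {f : F → F} {c : ℝ → F} {V : ℝ → F →L[ℝ] F}
    {s : Set ℝ} (h : IsIntegralCurveOn (fun t => (c t, V t)) (fun _ => firstVariation f) s) {t : ℝ}
    (ht : t ∈ s) : HasDerivWithinAt c (f (c t)) s t :=
  (h t ht).fst

theorem hasDerivWithinAt_snd_of_firstVariation {f : F → F} {c : ℝ → F} {V : ℝ → F →L[ℝ] F}
    {s : Set ℝ} (h : IsIntegralCurveOn (fun t => (c t, V t)) (fun _ => firstVariation f) s) {t : ℝ}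
    (ht : t ∈ s) : HasDerivWithinAt V ((fderiv ℝ f (c t)).comp (V t)) s t :=
  (h t ht).snd

theorem norm_sub_sub_firstVariation_le {f : F → F} {S : Set F} (hS : Convex ℝ S) {K : ℝ≥0}
    {M D ε : ℝ} (hd : ∀ y ∈ S, DifferentiableAt ℝ f y) (hlip : LipschitzOnWith K (fderiv ℝ f) S)
    (hM : ∀ y ∈ S, ‖fderiv ℝ f y‖ ≤ M) {c c' : ℝ → F} {V : ℝ → F →L[ℝ] F}
    (hc' : IsIntegralCurveOn c' (fun _ => f) (Icc 0 ε))
    (hcV : IsIntegralCurveOn (fun t => (c t, V t)) (fun _ => firstVariation f) (Icc 0 ε))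
    (hV : V 0 = .id ℝ F) (hcS : ∀ t ∈ Icc 0 ε, c t ∈ S) (hcS' : ∀ t ∈ Icc 0 ε, c' t ∈ S)
    (hD : ∀ t ∈ Icc 0 ε, ‖c' t - c t‖ ≤ D) {t : ℝ} (ht : t ∈ Icc 0 ε) :
    ‖c' t - c t - V t (c' 0 - c 0)‖ ≤ gronwallBound 0 M (K * D ^ 2) t := by
  set w := c' 0 - c 0
  have hderiv : ∀ s ∈ Icc 0 ε, HasDerivWithinAt (fun s => c' s - c s - V s w)
      (f (c' s) - f (c s) - fderiv ℝ f (c s) (V s w)) (Icc 0 ε) s := fun s hs =>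
    ((hc' s hs).sub (hasDerivWithinAt_fst_of_firstVariation hcV hs)).sub
      (((hasDerivWithinAt_snd_of_firstVariation hcV hs).clm_apply
        (hasDerivWithinAt_const s _ w)).congr_deriv (by simp))
  have hbound : ∀ s ∈ Icc 0 ε, ‖f (c' s) - f (c s) - fderiv ℝ f (c s) (V s w)‖ ≤
      M * ‖c' s - c s - V s w‖ + K * D ^ 2 := fun s hs =>
    calc ‖f (c' s) - f (c s) - fderiv ℝ f (c s) (V s w)‖
        = ‖fderiv ℝ f (c s) (c' s - c s - V s w) +
            (f (c' s) - f (c s) - fderiv ℝ f (c s) (c' s - c s))‖ := by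
          simp only [map_sub]; congr 1; abel
      _ ≤ M * ‖c' s - c s - V s w‖ + K * ‖c' s - c s‖ ^ 2 :=
          norm_add_le_of_le ((fderiv ℝ f (c s)).le_of_opNorm_le (hM _ (hcS s hs)) _)
            (norm_sub_sub_fderiv_le_of_lipschitzOnWith hS hd hlip (hcS s hs) (hcS' s hs))
      _ ≤ M * ‖c' s - c s - V s w‖ + K * D ^ 2 := by gcongr; exact hD s hs
  simpa only [sub_zero] using norm_le_gronwallBound_of_norm_deriv_right_le
    (fun s hs => (hderiv s hs).continuousWithinAt)
    (fun s hs => hasDerivWithinAt_Ici_of_Icc (hderiv s (Ico_subset_Icc_self hs)) hs)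
    (by simp [hV, w]) (fun s hs => hbound s (Ico_subset_Icc_self hs)) t ht

theorem hasFDerivAt_flow {f : F → F} {S U : Set F} (hS : Convex ℝ S) {K C : ℝ≥0} {M ε : ℝ}
    (hd : ∀ y ∈ S, DifferentiableAt ℝ f y) (hlip : LipschitzOnWith K (fderiv ℝ f) S)
    (hM : ∀ y ∈ S, ‖fderiv ℝ f y‖ ≤ M) {α : F → ℝ → F} {y : F} {V : ℝ → F →L[ℝ] F} (hU : U ∈ 𝓝 y)
    (h0 : ∀ z ∈ U, α z 0 = z) (hmem : ∀ z ∈ U, ∀ t ∈ Icc 0 ε, α z t ∈ S)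
    (hα : ∀ z ∈ U, IsIntegralCurveOn (α z) (fun _ => f) (Icc 0 ε))
    (hC : ∀ t ∈ Icc 0 ε, LipschitzOnWith C (α · t) U)
    (hV : IsIntegralCurveOn (fun t => (α y t, V t)) (fun _ => firstVariation f) (Icc 0 ε))
    (hV0 : V 0 = .id ℝ F) {t : ℝ} (ht : t ∈ Icc 0 ε) : HasFDerivAt (α · t) (V t) y := by
  have hy := mem_of_mem_nhds hU
  refine hasFDerivAt_of_norm_sub_sub_le_sq (C := gronwallBound 0 M (K * C ^ 2) t) ?_
  filter_upwards [hU] with z hz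
  have h := norm_sub_sub_firstVariation_le hS hd hlip hM (hα z hz) hV hV0 (hmem y hy) (hmem z hz)
    (fun s hs => (hC s hs).norm_sub_le hz hy) ht
  rwa [h0 z hz, h0 y hy, mul_pow, ← mul_assoc, mul_comm _ (‖z - y‖ ^ 2), gronwallBound_zero_mul,
    mul_comm] at h

theorem exists_ball_lipschitzOnWith_fderiv {f : F → F'} {y₀ : F} (hf : ContDiffAt ℝ 2 f y₀) :
    ∃ R > 0, ∃ K : ℝ≥0, (∀ y ∈ ball y₀ R, DifferentiableAt ℝ f y) ∧
      LipschitzOnWith K (fderiv ℝ f) (ball y₀ R) ∧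
      ∀ y ∈ ball y₀ R, ‖fderiv ℝ f y‖ ≤ ‖fderiv ℝ f y₀‖ + 1 := by
  have hf' : ContDiffAt ℝ 1 (fderiv ℝ f) y₀ := hf.fderiv_right (by norm_num)
  obtain ⟨K, s, hs, hK⟩ := hf'.exists_lipschitzOnWith
  have hd : ∀ᶠ y in 𝓝 y₀, DifferentiableAt ℝ f y :=
    (hf.eventually (by simp)).mono fun y hy => hy.differentiableAt (by norm_num)
  have hM : ∀ᶠ y in 𝓝 y₀, ‖fderiv ℝ f y‖ < ‖fderiv ℝ f y₀‖ + 1 :=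
    hf'.continuousAt.norm.eventually_lt continuousAt_const (by simp)
  obtain ⟨R, hR, hball⟩ := Metric.mem_nhds_iff.1 (hd.and (hM.and hs))
  exact ⟨R, hR, K, fun y hy => (hball hy).1, hK.mono fun y hy => (hball hy).2.2,
    fun y hy => (hball hy).2.1.le⟩

theorem contDiffAt_firstVariation {f : F → F} {p : F × (F →L[ℝ] F)}
    (hf : ContDiffAt ℝ 2 f p.1) : ContDiffAt ℝ 1 (firstVariation f) p :=
  ((hf.of_le one_le_two).comp p contDiffAt_fst).prodMk
    (((hf.fderiv_right (m := 1) (by norm_num)).comp p contDiffAt_fst).clm_comp contDiffAt_snd)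

variable [CompleteSpace F]

theorem exists_lipschitz_local_flow {f : F → F} {y₀ : F} (hf : ContDiffAt ℝ 1 f y₀) {W : Set F}
    (hW : W ∈ 𝓝 y₀) :
    ∃ ε > 0, ∃ U ∈ 𝓝 y₀, ∃ (α : F → ℝ → F) (C : ℝ≥0),
      (∀ y ∈ U, α y 0 = y ∧ IsIntegralCurveOn (α y) (fun _ => f) (Icc 0 ε) ∧
        ∀ t ∈ Icc 0 ε, α y t ∈ W) ∧ ∀ t ∈ Icc 0 ε, LipschitzOnWith C (α · t) U := by
  obtain ⟨ε, hε, a, r, L, K, hr, hpl⟩ := IsPicardLindelof.of_contDiffAt_one hf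
  obtain ⟨α, hα, C, hC⟩ := (hpl 0).exists_forall_mem_closedBall_eq_hasDerivWithinAt_lipschitzOnWith
  have hcont : ContinuousAt (Function.uncurry α) (y₀, 0) :=
    (continuousOn_prod_of_continuousOn_lipschitzOnWith _ C
      (fun x hx => HasDerivWithinAt.continuousOn (hα x hx).2) hC).continuousAt <|
        prod_mem_nhds (closedBall_mem_nhds _ hr) (Icc_mem_nhds (by linarith) (by linarith))
  have hαW : ∀ᶠ q in 𝓝 y₀ ×ˢ 𝓝 (0 : ℝ), α q.1 q.2 ∈ W := by
    rw [← nhds_prod_eq]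
    refine hcont ?_
    rwa [Function.uncurry_apply_pair, (hα y₀ (mem_closedBall_self r.2)).1]
  obtain ⟨P, hP, Q, hQ, hPQ⟩ := Filter.eventually_prod_iff.1 hαW
  obtain ⟨δ, hδ, hδQ⟩ := nhds_basis_closedBall.mem_iff.1 hQ
  have hsub : Icc 0 (min ε δ) ⊆ Icc (0 - ε) (0 + ε) := fun t ht =>
    ⟨by linarith [ht.1], by linarith [ht.2, min_le_left ε δ]⟩
  have hsubQ : ∀ t ∈ Icc 0 (min ε δ), Q t := fun t ht => hδQ <| by
    rw [mem_closedBall, dist_zero_right, Real.norm_of_nonneg ht.1]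
    exact ht.2.trans (min_le_right ε δ)
  exact ⟨min ε δ, lt_min hε hδ, _, Filter.inter_mem hP (closedBall_mem_nhds y₀ hr), α, C,
    fun y hy => ⟨(hα y hy.2).1, fun t ht => ((hα y hy.2).2 t (hsub ht)).mono hsub,
      fun t ht => hPQ hy.1 (hsubQ t ht)⟩,
    fun t ht => (hC t (hsub ht)).mono inter_subset_right⟩

theorem exists_differentiable_local_flow {f : F → F} {y₀ : F} (hf : ContDiffAt ℝ 2 f y₀)
    {W : Set F} (hW : W ∈ 𝓝 y₀) :
    ∃ ε > 0, ∃ U ∈ 𝓝 y₀, ∃ (α : F → ℝ → F) (V : F → ℝ → F →L[ℝ] F), ∀ y ∈ U,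
      α y 0 = y ∧ V y 0 = .id ℝ F ∧
      IsIntegralCurveOn (fun t => (α y t, V y t)) (fun _ => firstVariation f) (Icc 0 ε) ∧
      ∀ t ∈ Icc 0 ε, α y t ∈ W ∧ HasFDerivAt (α · t) (V y t) y := by
  obtain ⟨R, hR, K, hd, hK, hM⟩ := exists_ball_lipschitzOnWith_fderiv hf
  obtain ⟨ε, hε, U, hU, β, C, hβ, hC⟩ := exists_lipschitz_local_flow
    (contDiffAt_firstVariation (p := (y₀, .id ℝ F)) hf)
    (continuous_fst.continuousAt (Filter.inter_mem hW (ball_mem_nhds y₀ hR)))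
  have hι : Continuous fun y : F => (y, ContinuousLinearMap.id ℝ F) := by fun_prop
  obtain ⟨U', hU'U, hU'o, hyU'⟩ := _root_.mem_nhds_iff.1 (hι.continuousAt (x := y₀) hU)
  refine ⟨ε, hε, U', hU'o.mem_nhds hyU', fun y t => (β (y, .id ℝ F) t).1,
    fun y t => (β (y, .id ℝ F) t).2, fun y hy => ?_⟩
  have hβ0 : ∀ z ∈ U', β (z, .id ℝ F) 0 = (z, .id ℝ F) := fun z hz => (hβ _ (hU'U hz)).1
  have hβU' : ∀ z ∈ U', IsIntegralCurveOn (β (z, .id ℝ F)) (fun _ => firstVariation f) (Icc 0 ε) ∧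
      ∀ t ∈ Icc 0 ε, (β (z, .id ℝ F) t).1 ∈ W ∩ ball y₀ R := fun z hz => (hβ _ (hU'U hz)).2
  have hC' : ∀ t ∈ Icc 0 ε, LipschitzOnWith C (fun z => (β (z, .id ℝ F) t).1) U' := fun t ht => by
    have h := LipschitzWith.prod_fst.comp_lipschitzOnWith
      ((hC t ht).comp (LipschitzWith.prodMk_right (ContinuousLinearMap.id ℝ F)).lipschitzOnWith
        hU'U)
    rwa [one_mul, mul_one] at h
  exact ⟨congrArg Prod.fst (hβ0 y hy), congrArg Prod.snd (hβ0 y hy), (hβU' y hy).1, fun t ht =>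
    ⟨((hβU' y hy).2 t ht).1, hasFDerivAt_flow (convex_ball y₀ R) hd hK hM (hU'o.mem_nhds hy)
      (fun z hz => congrArg Prod.fst (hβ0 z hz)) (fun z hz t ht => ((hβU' z hz).2 t ht).2)
      (fun z hz t ht => hasDerivWithinAt_fst_of_firstVariation (hβU' z hz).1 ht) hC' (hβU' y hy).1
      (congrArg Prod.snd (hβ0 y hy)) ht⟩⟩

end LocalFlow

section Invariance
variable {F : Type*} [NormedAddCommGroup F] [NormedSpace ℝ F]

/-- The Lie derivative `£_X θ` of a one-form `θ` along a vector field `X`. -/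
def lieDerivOneForm (X : F → F) (θ : F → F →L[ℝ] ℝ) (y : F) : F →L[ℝ] ℝ :=
  fderiv ℝ θ y (X y) + (θ y).comp (fderiv ℝ X y)

theorem lieDerivOneForm_congr {X X' : F → F} {y : F} (h : X =ᶠ[𝓝 y] X') (θ : F → F →L[ℝ] ℝ) :
    lieDerivOneForm X θ y = lieDerivOneForm X' θ y := by
  rw [lieDerivOneForm, lieDerivOneForm, h.fderiv_eq, h.eq_of_nhds]

/-- The Lie derivative `£_X g` of a field of (not necessarily alternating) bilinear forms `g` along
a vector field `X`. -/
def lieDerivBilin (X : F → F) (g : F → F →L[ℝ] F →L[ℝ] ℝ) (y : F) : F →L[ℝ] F →L[ℝ] ℝ :=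
  fderiv ℝ g y (X y) + (g y).comp (fderiv ℝ X y) + (g y).bilinearComp (.id ℝ F) (fderiv ℝ X y)

theorem lieDerivBilin_apply (X : F → F) (g : F → F →L[ℝ] F →L[ℝ] ℝ) (y u u' : F) :
    lieDerivBilin X g y u u' = fderiv ℝ g y (X y) u u' + g y (fderiv ℝ X y u) u' +
      g y u (fderiv ℝ X y u') := rfl

theorem hasDerivWithinAt_bilin_along_flow {X : F → F} {g : F → F →L[ℝ] F →L[ℝ] ℝ} {s : Set ℝ}
    {c : ℝ → F} {V : ℝ → F →L[ℝ] F}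
    (hcV : IsIntegralCurveOn (fun t => (c t, V t)) (fun _ => firstVariation X) s) {t : ℝ}
    (ht : t ∈ s) (hg : DifferentiableAt ℝ g (c t)) (u u' : F) :
    HasDerivWithinAt (fun t => g (c t) (V t u) (V t u'))
      (lieDerivBilin X g (c t) (V t u) (V t u')) s t := by
  have hgc : HasDerivWithinAt (fun t => g (c t)) (fderiv ℝ g (c t) (X (c t))) s t :=
    HasFDerivAt.comp_hasDerivWithinAt (E := F →L[ℝ] F →L[ℝ] ℝ) (F := F) t hg.hasFDerivAt
      (hasDerivWithinAt_fst_of_firstVariation hcV ht)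
  have hV := hasDerivWithinAt_snd_of_firstVariation hcV ht
  refine ((hgc.clm_apply (hV.clm_apply (hasDerivWithinAt_const t _ u))).clm_apply
    (hV.clm_apply (hasDerivWithinAt_const t _ u'))).congr_deriv ?_
  simp only [lieDerivBilin_apply, ContinuousLinearMap.comp_apply, map_zero, add_zero,
    _root_.add_apply]

theorem alternation_const_along_flow {X : F → F} {g : F → F →L[ℝ] F →L[ℝ] ℝ} {ε : ℝ}
    {c : ℝ → F} {V : ℝ → F →L[ℝ] F}
    (hcV : IsIntegralCurveOn (fun t => (c t, V t)) (fun _ => firstVariation X) (Icc 0 ε))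
    (hg : ∀ t ∈ Icc 0 ε, DifferentiableAt ℝ g (c t))
    (hL : ∀ t ∈ Icc 0 ε, ∀ w w', lieDerivBilin X g (c t) w w' = lieDerivBilin X g (c t) w' w)
    (u u' : F) {t : ℝ} (ht : t ∈ Icc 0 ε) :
    g (c t) (V t u) (V t u') - g (c t) (V t u') (V t u) =
      g (c 0) (V 0 u) (V 0 u') - g (c 0) (V 0 u') (V 0 u) := by
  have hd : ∀ s ∈ Icc 0 ε, HasDerivWithinAt
      (fun s => g (c s) (V s u) (V s u') - g (c s) (V s u') (V s u)) 0 (Icc 0 ε) s := fun s hs =>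
    ((hasDerivWithinAt_bilin_along_flow hcV hs (hg s hs) u u').sub
      (hasDerivWithinAt_bilin_along_flow hcV hs (hg s hs) u' u)).congr_deriv
        (sub_eq_zero.2 (hL s hs _ _))
  exact constant_of_has_deriv_right_zero (fun s hs => (hd s hs).continuousWithinAt)
    (fun s hs => hasDerivWithinAt_Ici_of_Icc (hd s (Ico_subset_Icc_self hs)) hs) t ht

theorem fderiv_lieDerivOneForm_apply {X : F → F} {θ : F → F →L[ℝ] ℝ} {y : F}
    (hX : ContDiffAt ℝ 2 X y) (hθ : ContDiffAt ℝ 2 θ y) (u u' : F) :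
    fderiv ℝ (lieDerivOneForm X θ) y u u' =
      lieDerivBilin X (fderiv ℝ θ) y u u' + θ y (fderiv ℝ (fderiv ℝ X) y u u') := by
  have hX' := (hX.differentiableAt (by norm_num)).hasFDerivAt
  have hθ' := (hθ.differentiableAt (by norm_num)).hasFDerivAt
  have hX'' := ((hX.fderiv_right (m := 1) (by norm_num)).differentiableAt (by norm_num)).hasFDerivAt
  have hθ'' := ((hθ.fderiv_right (m := 1) (by norm_num)).differentiableAt (by norm_num)).hasFDerivAt
  have h : HasFDerivAt (lieDerivOneForm X θ) _ y :=
    (hθ''.clm_apply hX').add (hθ'.clm_comp hX'')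
  have hsymm : fderiv ℝ (fderiv ℝ θ) y u (X y) = fderiv ℝ (fderiv ℝ θ) y (X y) u :=
    hθ.isSymmSndFDerivAt (by simp) u (X y)
  rw [h.fderiv, lieDerivBilin_apply]
  simp [hsymm]
  ring

theorem lieDerivBilin_fderiv_symm {X : F → F} {θ : F → F →L[ℝ] ℝ} {l : F → ℝ} {y : F}
    (hX : ContDiffAt ℝ 2 X y) (hθ : ContDiffAt ℝ 2 θ y) (hl : ContDiffAt ℝ 2 l y)
    (h : lieDerivOneForm X θ =ᶠ[𝓝 y] fderiv ℝ l) (u u' : F) :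
    lieDerivBilin X (fderiv ℝ θ) y u u' = lieDerivBilin X (fderiv ℝ θ) y u' u := by
  have hD : ∀ w w', lieDerivBilin X (fderiv ℝ θ) y w w' =
      fderiv ℝ (fderiv ℝ l) y w w' - θ y (fderiv ℝ (fderiv ℝ X) y w w') := fun w w' => by
    rw [← h.fderiv_eq, fderiv_lieDerivOneForm_apply hX hθ, add_sub_cancel_right]
  rw [hD, hD, hl.isSymmSndFDerivAt (by simp) u u', hX.isSymmSndFDerivAt (by simp) u u']

end Invariance

section Pullback
variable {E₁ : Type*} [NormedAddCommGroup E₁] [NormedSpace ℝ E₁]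
  {H₁ : Type*} [TopologicalSpace H₁] {I₁ : ModelWithCorners ℝ E₁ H₁}
  {M₁ : Type*} [TopologicalSpace M₁] [ChartedSpace H₁ M₁]
  {E₂ : Type*} [NormedAddCommGroup E₂] [NormedSpace ℝ E₂]
  {H₂ : Type*} [TopologicalSpace H₂] {I₂ : ModelWithCorners ℝ E₂ H₂}
  {M₂ : Type*} [TopologicalSpace M₂] [ChartedSpace H₂ M₂]
  {E₃ : Type*} [NormedAddCommGroup E₃] [NormedSpace ℝ E₃]
  {H₃ : Type*} [TopologicalSpace H₃] {I₃ : ModelWithCorners ℝ E₃ H₃}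
  {M₃ : Type*} [TopologicalSpace M₃] [ChartedSpace H₃ M₃]
  {V : Type*} [NormedAddCommGroup V] [NormedSpace ℝ V] {k : ℕ}

variable (I₁ I₂) in
/-- The manifold derivative as a linear map between the model vector spaces. Compared with `mfderiv`
its type does not mention the base points, so that these can be rewritten. -/
def modelDeriv (f : M₁ → M₂) (x : M₁) : E₁ →L[ℝ] E₂ := mfderiv I₁ I₂ f x

theorem modelDeriv_comp {f : M₁ → M₂} {g : M₂ → M₃} {x : M₁}
    (hg : MDifferentiableAt I₂ I₃ g (f x)) (hf : MDifferentiableAt I₁ I₂ f x) :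
    modelDeriv I₁ I₃ (g ∘ f) x = (modelDeriv I₂ I₃ g (f x)).comp (modelDeriv I₁ I₂ f x) :=
  mfderiv_comp x hg hf

theorem modelDeriv_congr {f g : M₁ → M₂} {x : M₁} (h : f =ᶠ[𝓝 x] g) :
    modelDeriv I₁ I₂ f x = modelDeriv I₁ I₂ g x :=
  h.mfderiv_eq

theorem modelDeriv_eq_fderiv (f : E₁ → E₂) (x : E₁) :
    modelDeriv 𝓘(ℝ, E₁) 𝓘(ℝ, E₂) f x = fderiv ℝ f x :=
  mfderiv_eq_fderiv

theorem formPullback_comp (α : DiffForm I₃ M₃ k) {f : M₁ → M₂} {g : M₂ → M₃} {x : M₁}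
    (hg : MDifferentiableAt I₂ I₃ g (f x)) (hf : MDifferentiableAt I₁ I₂ f x) :
    formPullback I₁ I₃ (g ∘ f) α x = formPullback I₁ I₂ f (formPullback I₂ I₃ g α) x :=
  congrArg (fun A : E₁ →L[ℝ] E₃ =>
    (α (g (f x)) : E₃ [⋀^Fin k]→L[ℝ] ℝ).compContinuousLinearMap A) (modelDeriv_comp hg hf)

theorem formPullback_congr (α : DiffForm I₂ M₂ k) {f g : M₁ → M₂} {x : M₁} (h : f =ᶠ[𝓝 x] g) :
    formPullback I₁ I₂ f α x = formPullback I₁ I₂ g α x :=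
  congrArg₂ (fun (y : M₂) (A : E₁ →L[ℝ] E₂) =>
    (α y : E₂ [⋀^Fin k]→L[ℝ] ℝ).compContinuousLinearMap A) h.eq_of_nhds (modelDeriv_congr h)

theorem formPullback_formPullback_eq_of_semiconj {α : DiffForm I₂ M₂ k} {m : M₁ → M₂}
    {Φ : M₁ → M₁} {Ψ : M₂ → M₂} {x : M₁} (h : m ∘ Φ =ᶠ[𝓝 x] Ψ ∘ m)
    (hΦ : MDifferentiableAt I₁ I₁ Φ x) (hmΦ : MDifferentiableAt I₁ I₂ m (Φ x))
    (hm : MDifferentiableAt I₁ I₂ m x) (hΨ : MDifferentiableAt I₂ I₂ Ψ (m x))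
    (hα : formPullback I₂ I₂ Ψ α (m x) = α (m x)) :
    formPullback I₁ I₁ Φ (formPullback I₁ I₂ m α) x = formPullback I₁ I₂ m α x := by
  rw [← formPullback_comp α hmΦ hΦ, formPullback_congr α h, formPullback_comp α hΨ hm]
  exact congrArg (fun β : E₂ [⋀^Fin k]→L[ℝ] ℝ =>
    β.compContinuousLinearMap (modelDeriv I₁ I₂ m x)) hα

theorem exteriorDerivative_eq_of_eventually_formPullback [I₁.Boundaryless] [IsManifold I₁ 2 M₁]
    {α : DiffForm I₁ M₁ k} {θ : V → V [⋀^Fin k]→L[ℝ] ℝ} {ψ : M₁ → V} {x : M₁}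
    (hψ : ContMDiffAt I₁ 𝓘(ℝ, V) 2 ψ x) (hθ : DifferentiableAt ℝ θ (ψ x))
    (h : ∀ᶠ z in 𝓝 x, α z = formPullback I₁ 𝓘(ℝ, V) ψ θ z) :
    exteriorDerivative I₁ α x = formPullback I₁ 𝓘(ℝ, V) ψ (extDeriv θ) x := by
  have : IsManifold I₁ 1 M₁ := IsManifold.of_le one_le_two
  let c := extChartAt I₁ x
  have hcx : c.symm (c x) = x := extChartAt_to_inv x
  have hsymm : ContMDiffAt 𝓘(ℝ, E₁) I₁ 2 c.symm (c x) :=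
    (contMDiffOn_extChartAt_symm x).contMDiffAt (extChartAt_target_mem_nhds x)
  have hS : ContMDiffAt 𝓘(ℝ, E₁) 𝓘(ℝ, V) 2 (ψ ∘ c.symm) (c x) :=
    ContMDiffAt.comp (c x) (by rwa [hcx]) hsymm
  have hψd : ∀ᶠ z in 𝓝 (c.symm (c x)), MDifferentiableAt I₁ 𝓘(ℝ, V) ψ z := by
    rw [hcx]
    exact ((contMDiffAt_iff_contMDiffAt_nhds (by simp)).1 hψ).mono
      fun z hz => hz.mdifferentiableAt two_ne_zero
  have hα : (fun y : E₁ => ((α (c.symm y)).compContinuousLinearMap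
      (mfderivWithin 𝓘(ℝ, E₁) I₁ c.symm (range I₁) y) : E₁ [⋀^Fin k]→L[ℝ] ℝ)) =ᶠ[𝓝 (c x)]
      fun y => (θ (ψ (c.symm y))).compContinuousLinearMap (fderiv ℝ (ψ ∘ c.symm) y) := by
    filter_upwards [hsymm.continuousAt.eventually hψd, hsymm.continuousAt.eventually (hcx ▸ h),
      (contMDiffAt_iff_contMDiffAt_nhds (by simp)).1 hsymm] with y hy hαy hsy
    rw [I₁.range_eq_univ, mfderivWithin_univ, hαy, ← mfderiv_eq_fderiv]
    exact (formPullback_comp θ hy (hsy.mdifferentiableAt two_ne_zero)).symm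
  have hd : extDerivWithin (fun y : E₁ => ((α (c.symm y)).compContinuousLinearMap
      (mfderivWithin 𝓘(ℝ, E₁) I₁ c.symm (range I₁) y) : E₁ [⋀^Fin k]→L[ℝ] ℝ)) (range I₁) (c x) =
      formPullback 𝓘(ℝ, E₁) 𝓘(ℝ, V) (ψ ∘ c.symm) (extDeriv θ) (c x) := by
    rw [hα.extDerivWithin_eq_nhds, I₁.range_eq_univ, extDerivWithin_univ]
    refine (extDeriv_pullback (by rwa [Function.comp_apply, hcx]) hS.contDiffAt
      (by rw [minSmoothness_of_isRCLikeNormedField])).trans ?_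
    rw [← mfderiv_eq_fderiv]
    rfl
  have hψc : (ψ ∘ c.symm) ∘ c =ᶠ[𝓝 x] ψ := by
    filter_upwards [extChartAt_source_mem_nhds (I := I₁) x] with z hz
    exact congrArg ψ (c.left_inv hz)
  refine (congrArg (fun β : E₁ [⋀^Fin (k + 1)]→L[ℝ] ℝ =>
    β.compContinuousLinearMap (modelDeriv I₁ 𝓘(ℝ, E₁) c x)) hd).trans ?_
  rw [← formPullback_congr (extDeriv θ) hψc]
  exact (formPullback_comp (extDeriv θ) (hS.mdifferentiableAt two_ne_zero)
    (mdifferentiableAt_extChartAt (mem_chart_source H₁ x))).symm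

/-- A field of linear functionals on a vector space, as a differential one-form. -/
def toOneForm (θ : V → V →L[ℝ] ℝ) (y : V) : V [⋀^Fin 1]→L[ℝ] ℝ :=
  ContinuousAlternatingMap.ofSubsingleton ℝ V ℝ (0 : Fin 1) (θ y)

theorem differentiableAt_toOneForm {θ : V → V →L[ℝ] ℝ} {y : V} (hθ : DifferentiableAt ℝ θ y) :
    DifferentiableAt ℝ (toOneForm θ) y :=
  (ContinuousAlternatingMap.ofSubsingletonLIE (𝕜 := ℝ) (E := V) (F := ℝ)
    (0 : Fin 1)).toContinuousLinearEquiv.differentiableAt.comp y hθ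

theorem extDeriv_toOneForm_apply {θ : V → V →L[ℝ] ℝ} {y : V} (hθ : DifferentiableAt ℝ θ y)
    (w : Fin 2 → V) :
    extDeriv (toOneForm θ) y w = fderiv ℝ θ y (w 0) (w 1) - fderiv ℝ θ y (w 1) (w 0) := by
  have h : ∀ u v : V, fderiv ℝ (fun y => θ y u) y v = fderiv ℝ θ y v u := fun u v => by
    rw [(hθ.hasFDerivAt.clm_apply (hasFDerivAt_const u y)).fderiv]
    simp
  rw [extDeriv_apply (differentiableAt_toOneForm hθ), Fin.sum_univ_two]
  simp [toOneForm, Fin.removeNth, Fin.tail, h, sub_eq_add_neg]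

end Pullback

section Charts
variable {F : Type*} [NormedAddCommGroup F] [NormedSpace ℝ F]
  {HN : Type*} [TopologicalSpace HN] {J : ModelWithCorners ℝ F HN}
  {N : Type*} [TopologicalSpace N] [ChartedSpace HN N]

/-- The representation of a vector field in the preferred chart at `x₀`. -/
def chartField (v : ∀ x : N, TangentSpace J x) (x₀ : N) (y : F) : F :=
  modelDeriv J 𝓘(ℝ, F) (extChartAt J x₀) ((extChartAt J x₀).symm y) (v ((extChartAt J x₀).symm y))

theorem chartField_extChartAt (v : ∀ x : N, TangentSpace J x) {x₀ x : N}
    (hx : x ∈ (extChartAt J x₀).source) :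
    chartField v x₀ (extChartAt J x₀ x) = modelDeriv J 𝓘(ℝ, F) (extChartAt J x₀) x (v x) := by
  rw [chartField, (extChartAt J x₀).left_inv hx]

theorem mdifferentiableAt_extChartAt_of_mem_source [IsManifold J 1 N] {x₀ x : N}
    (hx : x ∈ (extChartAt J x₀).source) :
    MDifferentiableAt J 𝓘(ℝ, F) (extChartAt J x₀) x :=
  mdifferentiableAt_extChartAt (by rwa [extChartAt_source] at hx)

theorem trivializationAt_snd_eq_modelDeriv_extChartAt [IsManifold J 1 N] {x₀ x : N}
    (hx : x ∈ (extChartAt J x₀).source) (v : TangentSpace J x) :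
    (trivializationAt F (TangentSpace J) x₀ (⟨x, v⟩ : TangentBundle J N)).2 =
      modelDeriv J 𝓘(ℝ, F) (extChartAt J x₀) x v := by
  have hx' : x ∈ (chartAt HN x₀).source := by rwa [extChartAt_source] at hx
  have hbase : x ∈ (trivializationAt F (TangentSpace J) x₀).baseSet := by simpa using hx'
  exact (congrFun (Trivialization.coe_linearMapAt_of_mem (R := ℝ) _ hbase) v).symm.trans <|
    congrArg (fun A : F →L[ℝ] F => A v) (TangentBundle.continuousLinearMapAt_trivializationAt hx')

variable [J.Boundaryless]

theorem contMDiffAt_extChartAt_symm {n : WithTop ℕ∞} [IsManifold J n N] {x₀ : N} {y : F}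
    (hy : y ∈ (extChartAt J x₀).target) : ContMDiffAt 𝓘(ℝ, F) J n (extChartAt J x₀).symm y :=
  (contMDiffOn_extChartAt_symm x₀).contMDiffAt ((isOpen_extChartAt_target x₀).mem_nhds hy)

theorem contMDiff_iff_contDiffOn_chartField [IsManifold J ∞ N] {v : ∀ x : N, TangentSpace J x} :
    ContMDiff J J.tangent ∞ (fun x => (⟨x, v x⟩ : TangentBundle J N)) ↔
      ∀ x₀, ContDiffOn ℝ ∞ (chartField v x₀) (extChartAt J x₀).target := by
  have htriv : ∀ x₀ : N, ∀ x ∈ (extChartAt J x₀).source,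
      (trivializationAt F (TangentSpace J) x₀ (⟨x, v x⟩ : TangentBundle J N)).2 =
        chartField v x₀ (extChartAt J x₀ x) := fun x₀ x hx => by
    rw [chartField_extChartAt v hx, trivializationAt_snd_eq_modelDeriv_extChartAt hx]
  constructor
  · intro hv x₀ y hy
    have hx := (extChartAt J x₀).map_target hy
    have hsec := ((trivializationAt F (TangentSpace J) x₀).contMDiffAt_section_iff
      (by simpa using hx)).1 (hv.contMDiffAt (x := (extChartAt J x₀).symm y))
    refine (contMDiffAt_iff_contDiffAt.1 ((hsec.comp y
      (contMDiffAt_extChartAt_symm hy)).congr_of_eventuallyEq ?_)).contDiffWithinAt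
    filter_upwards [(isOpen_extChartAt_target x₀).mem_nhds hy] with z hz
    rw [Function.comp_apply, htriv x₀ _ ((extChartAt J x₀).map_target hz),
      (extChartAt J x₀).right_inv hz]
  · intro hv x₀
    have hchart := ((hv x₀).contDiffAt (extChartAt_target_mem_nhds x₀)).contMDiffAt.comp x₀
      contMDiffAt_extChartAt
    refine (contMDiffAt_section x₀).2 (hchart.congr_of_eventuallyEq ?_)
    filter_upwards [extChartAt_source_mem_nhds (I := J) x₀] with x hx using htriv x₀ x hx

variable [IsManifold J 1 N]

theorem mdifferentiableAt_extChartAt_symm {x₀ : N} {y : F} (hy : y ∈ (extChartAt J x₀).target) :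
    MDifferentiableAt 𝓘(ℝ, F) J (extChartAt J x₀).symm y :=
  (contMDiffAt_extChartAt_symm (n := 1) hy).mdifferentiableAt one_ne_zero

theorem modelDeriv_extChartAt_symm_modelDeriv_extChartAt {x₀ : N} {y : F}
    (hy : y ∈ (extChartAt J x₀).target) (w : F) :
    modelDeriv 𝓘(ℝ, F) J (extChartAt J x₀).symm y
      (modelDeriv J 𝓘(ℝ, F) (extChartAt J x₀) ((extChartAt J x₀).symm y) w) = w := by
  have h := mfderivWithin_extChartAt_symm_comp_mfderiv_extChartAt (I := J) hy
  rw [J.range_eq_univ, mfderivWithin_univ] at h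
  exact congrArg (fun A : F →L[ℝ] F => A w) h

theorem modelDeriv_extChartAt_modelDeriv_extChartAt_symm {x₀ : N} {y : F}
    (hy : y ∈ (extChartAt J x₀).target) (w : F) :
    modelDeriv J 𝓘(ℝ, F) (extChartAt J x₀) ((extChartAt J x₀).symm y)
      (modelDeriv 𝓘(ℝ, F) J (extChartAt J x₀).symm y w) = w := by
  have h := mfderiv_extChartAt_comp_mfderivWithin_extChartAt_symm (I := J) hy
  rw [J.range_eq_univ, mfderivWithin_univ] at h
  exact congrArg (fun A : F →L[ℝ] F => A w) h

end Charts

section InvariantFlow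
variable {F : Type*} [NormedAddCommGroup F] [NormedSpace ℝ F] [CompleteSpace F]

theorem exists_local_flow_formPullback_extDeriv_eq {X : F → F} {θ : F → F →L[ℝ] ℝ} {l : F → ℝ}
    {W : Set F} {y₀ : F} (hW : W ∈ 𝓝 y₀) (hX : ∀ y ∈ W, ContDiffAt ℝ 2 X y)
    (hθ : ∀ y ∈ W, ContDiffAt ℝ 2 θ y) (hl : ∀ y ∈ W, ContDiffAt ℝ 2 l y)
    (h : ∀ y ∈ W, lieDerivOneForm X θ =ᶠ[𝓝 y] fderiv ℝ l) :
    ∃ ε > 0, ∃ U ∈ 𝓝 y₀, ∃ α : F → ℝ → F, ∀ y ∈ U, α y 0 = y ∧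
      IsIntegralCurveOn (α y) (fun _ => X) (Icc 0 ε) ∧ ∀ t ∈ Icc 0 ε, α y t ∈ W ∧
        DifferentiableAt ℝ (α · t) y ∧
        formPullback 𝓘(ℝ, F) 𝓘(ℝ, F) (α · t) (extDeriv (toOneForm θ)) y =
          extDeriv (toOneForm θ) y := by
  obtain ⟨ε, hε, U, hU, α, V, hαV⟩ :=
    exists_differentiable_local_flow (hX y₀ (mem_of_mem_nhds hW)) hW
  refine ⟨ε, hε, U, hU, α, fun y hy => ?_⟩
  obtain ⟨hα0, hV0, hcurve, hflow⟩ := hαV y hy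
  refine ⟨hα0, fun t ht => hasDerivWithinAt_fst_of_firstVariation hcurve ht, fun t ht =>
    ⟨(hflow t ht).1, (hflow t ht).2.differentiableAt, ContinuousAlternatingMap.ext fun w => ?_⟩⟩
  have hdθ : ∀ s ∈ Icc 0 ε, ContDiffAt ℝ 1 (fderiv ℝ θ) (α y s) := fun s hs =>
    (hθ _ (hflow s hs).1).fderiv_right (by norm_num)
  have hconst := alternation_const_along_flow hcurve
    (fun s hs => (hdθ s hs).differentiableAt one_ne_zero)
    (fun s hs => lieDerivBilin_fderiv_symm (hX _ (hflow s hs).1) (hθ _ (hflow s hs).1)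
      (hl _ (hflow s hs).1) (h _ (hflow s hs).1)) (w 0) (w 1) ht
  have hdiff : ∀ s ∈ Icc 0 ε, DifferentiableAt ℝ θ (α y s) := fun s hs =>
    (hθ _ (hflow s hs).1).differentiableAt two_ne_zero
  have hy' : DifferentiableAt ℝ θ y := hα0 ▸ hdiff 0 ⟨le_rfl, hε.le⟩
  change extDeriv (toOneForm θ) (α y t)
    (fun i => modelDeriv 𝓘(ℝ, F) 𝓘(ℝ, F) (α · t) y (w i)) = _
  rw [modelDeriv_eq_fderiv, (hflow t ht).2.fderiv, extDeriv_toOneForm_apply (hdiff t ht),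
    hconst, hα0, hV0]
  exact (extDeriv_toOneForm_apply hy' w).symm

end InvariantFlow

section IntegralCurves
variable {F : Type*} [NormedAddCommGroup F] [NormedSpace ℝ F]
  {HN : Type*} [TopologicalSpace HN] {J : ModelWithCorners ℝ F HN}
  {N : Type*} [TopologicalSpace N] [ChartedSpace HN N] {v : ∀ x : N, TangentSpace J x}

theorem isMIntegralCurveOn_congr {γ γ' : ℝ → N} {s : Set ℝ} (h : EqOn γ γ' s)
    (hγ' : IsMIntegralCurveOn γ' v s) : IsMIntegralCurveOn γ v s := fun t ht => by
  rw [h ht]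
  exact (hγ' t ht).congr_of_eventuallyEq (h.eventuallyEq_of_mem self_mem_nhdsWithin) (h ht)

theorem isMIntegralCurveOn_Icc_union {γ : ℝ → N} {a b c : ℝ} (hab : a ≤ b) (hbc : b ≤ c)
    (h₁ : IsMIntegralCurveOn γ v (Icc a b)) (h₂ : IsMIntegralCurveOn γ v (Icc b c)) :
    IsMIntegralCurveOn γ v (Icc a c) := by
  intro t ht
  rcases lt_trichotomy t b with hlt | rfl | hgt
  · refine (h₁ t ⟨ht.1, hlt.le⟩).mono_of_mem_nhdsWithin ?_
    filter_upwards [self_mem_nhdsWithin, mem_nhdsWithin_of_mem_nhds (Iio_mem_nhds hlt)]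
      with q hq hqb using ⟨hq.1, hqb.le⟩
  · rw [← Icc_union_Icc_eq_Icc hab hbc]
    exact (h₁ t ⟨hab, le_rfl⟩).union (h₂ t ⟨le_rfl, hbc⟩)
  · refine (h₂ t ⟨hgt.le, ht.2⟩).mono_of_mem_nhdsWithin ?_
    filter_upwards [self_mem_nhdsWithin, mem_nhdsWithin_of_mem_nhds (Ioi_mem_nhds hgt)]
      with q hq hqb using ⟨hqb.le, hq.2⟩

theorem hasDerivWithinAt_extChartAt_comp [IsManifold J 1 N] {x₀ : N} {γ : ℝ → N} {s : Set ℝ}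
    {t : ℝ} (hγ : HasMFDerivWithinAt 𝓘(ℝ, ℝ) J γ s t ((1 : ℝ →L[ℝ] ℝ).smulRight (v (γ t))))
    (ht : γ t ∈ (extChartAt J x₀).source) :
    HasDerivWithinAt (extChartAt J x₀ ∘ γ) (chartField v x₀ (extChartAt J x₀ (γ t))) s t := by
  have h : HasFDerivWithinAt (extChartAt J x₀ ∘ γ) ((modelDeriv J 𝓘(ℝ, F) (extChartAt J x₀)
      (γ t)).comp ((1 : ℝ →L[ℝ] ℝ).smulRight (v (γ t) : F))) s t :=
    ((mdifferentiableAt_extChartAt_of_mem_source ht).hasMFDerivAt.comp_hasMFDerivWithinAt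
      t hγ).hasFDerivWithinAt
  rw [chartField_extChartAt v ht]
  exact h.hasDerivWithinAt.congr_deriv (congrArg _ (one_smul ℝ (v (γ t) : F)))

variable [J.Boundaryless]

theorem hasMFDerivWithinAt_extChartAt_symm_comp [IsManifold J 1 N] {x₀ : N} {c : ℝ → F} {s : Set ℝ}
    {t : ℝ} (hc : HasDerivWithinAt c (chartField v x₀ (c t)) s t)
    (ht : c t ∈ (extChartAt J x₀).target) :
    HasMFDerivWithinAt 𝓘(ℝ, ℝ) J ((extChartAt J x₀).symm ∘ c) s t
      ((1 : ℝ →L[ℝ] ℝ).smulRight (v ((extChartAt J x₀).symm (c t)))) := by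
  have h := (mdifferentiableAt_extChartAt_symm ht).hasMFDerivAt.comp_hasMFDerivWithinAt t
    hc.hasFDerivWithinAt.hasMFDerivWithinAt
  have hv : (modelDeriv 𝓘(ℝ, F) J (extChartAt J x₀).symm (c t)).comp
      (ContinuousLinearMap.toSpanSingleton ℝ (chartField v x₀ (c t))) =
      (1 : ℝ →L[ℝ] ℝ).smulRight (v ((extChartAt J x₀).symm (c t)) : F) := by
    refine ContinuousLinearMap.ext_ring ?_
    rw [ContinuousLinearMap.comp_apply, ContinuousLinearMap.toSpanSingleton_apply, one_smul]
    exact (modelDeriv_extChartAt_symm_modelDeriv_extChartAt ht _).trans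
      (one_smul ℝ (v ((extChartAt J x₀).symm (c t)) : F)).symm
  exact h.congr_mfderiv hv

variable [IsManifold J ∞ N]

theorem contDiffAt_chartField (hv : ContMDiff J J.tangent ∞ fun x => (⟨x, v x⟩ : TangentBundle J N))
    {x₀ : N} {y : F} (hy : y ∈ (extChartAt J x₀).target) : ContDiffAt ℝ ∞ (chartField v x₀) y :=
  (contMDiff_iff_contDiffOn_chartField.1 hv x₀).contDiffAt
    ((isOpen_extChartAt_target x₀).mem_nhds hy)

theorem exists_Icc_eqOn_of_isMIntegralCurveOn
    (hv : ContMDiff J J.tangent ∞ fun x => (⟨x, v x⟩ : TangentBundle J N)) {γ γ' : ℝ → N} {t b : ℝ}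
    (htb : t < b) (hγ : IsMIntegralCurveOn γ v (Icc t b)) (hγ' : IsMIntegralCurveOn γ' v (Icc t b))
    (h : γ t = γ' t) : ∃ r > t, EqOn γ γ' (Icc t r) := by
  have ht : t ∈ Icc t b := ⟨le_rfl, htb.le⟩
  obtain ⟨K, S, hS, hlip⟩ := ((contDiffAt_chartField hv (mem_extChartAt_target (I := J)
    (γ t))).of_le (by simp)).exists_lipschitzOnWith
  have hA : {x | x ∈ (extChartAt J (γ t)).source ∧ extChartAt J (γ t) x ∈ S} ∈ 𝓝 (γ t) :=
    Filter.inter_mem (extChartAt_source_mem_nhds (γ t)) (continuousAt_extChartAt (γ t) hS)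
  have hmem : ∀ᶠ q in 𝓝[≥] t, q ≤ b ∧
      (γ q ∈ (extChartAt J (γ t)).source ∧ extChartAt J (γ t) (γ q) ∈ S) ∧
      (γ' q ∈ (extChartAt J (γ t)).source ∧ extChartAt J (γ t) (γ' q) ∈ S) := by
    rw [← nhdsWithin_Icc_eq_nhdsGE htb]
    filter_upwards [self_mem_nhdsWithin, hγ.continuousOn t ht hA,
      hγ'.continuousOn t ht (by rwa [← h])] with q hq h₁ h₂ using ⟨hq.2, h₁, h₂⟩
  obtain ⟨r, hr, hsub⟩ := mem_nhdsGE_iff_exists_Icc_subset.1 hmem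
  have hcurve : ∀ {δ : ℝ → N}, IsMIntegralCurveOn δ v (Icc t b) → ∀ q ∈ Icc t r,
      δ q ∈ (extChartAt J (γ t)).source → HasDerivWithinAt (extChartAt J (γ t) ∘ δ)
        (chartField v (γ t) (extChartAt J (γ t) (δ q))) (Icc t r) q := fun hδ q hq hqs =>
    hasDerivWithinAt_extChartAt_comp
      (hδ.mono (Icc_subset_Icc_right (hsub ⟨le_of_lt hr, le_rfl⟩).1) q hq) hqs
  have hd := fun q hq => hcurve hγ q hq (hsub hq).2.1.1
  have hd' := fun q hq => hcurve hγ' q hq (hsub hq).2.2.1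
  have huniq := ODE_solution_unique_of_mem_Icc_right (K := K) (s := fun _ => S)
    (v := fun _ => chartField v (γ t)) (fun _ _ => hlip)
    (fun q hq => (hd q hq).continuousWithinAt)
    (fun q hq => hasDerivWithinAt_Ici_of_Icc (hd q (Ico_subset_Icc_self hq)) hq)
    (fun q hq => (hsub (Ico_subset_Icc_self hq)).2.1.2)
    (fun q hq => (hd' q hq).continuousWithinAt)
    (fun q hq => hasDerivWithinAt_Ici_of_Icc (hd' q (Ico_subset_Icc_self hq)) hq)
    (fun q hq => (hsub (Ico_subset_Icc_self hq)).2.2.2) (by simp [h])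
  exact ⟨r, hr, fun q hq =>
    (extChartAt J (γ t)).injOn (hsub hq).2.1.1 (hsub hq).2.2.1 (huniq hq)⟩

theorem isMIntegralCurveOn_Icc_eqOn [T2Space N]
    (hv : ContMDiff J J.tangent ∞ fun x => (⟨x, v x⟩ : TangentBundle J N)) {γ γ' : ℝ → N} {a b : ℝ}
    (hγ : IsMIntegralCurveOn γ v (Icc a b)) (hγ' : IsMIntegralCurveOn γ' v (Icc a b))
    (h : γ a = γ' a) : EqOn γ γ' (Icc a b) := by
  have hclosed : IsClosed ({t | γ t = γ' t} ∩ Icc a b) := by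
    rw [inter_comm]
    exact (hγ.continuousOn.prodMk hγ'.continuousOn).preimage_isClosed_of_isClosed isClosed_Icc
      isClosed_diagonal
  refine hclosed.Icc_subset_of_forall_exists_gt h fun t ⟨ht, hta, htb⟩ s hts => ?_
  obtain ⟨r, hr, heq⟩ := exists_Icc_eqOn_of_isMIntegralCurveOn hv htb
    (hγ.mono (Icc_subset_Icc_left hta)) (hγ'.mono (Icc_subset_Icc_left hta)) ht
  have htr : t < min r s := lt_min hr hts
  exact ⟨min r s, heq ⟨htr.le, min_le_left r s⟩, htr, min_le_right r s⟩

end IntegralCurves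

section ManifoldFlow
variable {F : Type*} [NormedAddCommGroup F] [NormedSpace ℝ F]
  {HN : Type*} [TopologicalSpace HN] {J : ModelWithCorners ℝ F HN}
  {N : Type*} [TopologicalSpace N] [ChartedSpace HN N] {v : ∀ x : N, TangentSpace J x}
  {k : ℕ} {s t : ℝ}

/-- The flow of `v` sends `x` to `y` in time `s`: some integral curve of `v` on `[0, s]` goes from
`x` to `y`. As the flow need not be globally defined, it is encoded as a relation. -/
def FlowRel (v : ∀ x : N, TangentSpace J x) (s : ℝ) (x y : N) : Prop :=
  ∃ γ : ℝ → N, γ 0 = x ∧ γ s = y ∧ IsMIntegralCurveOn γ v (Icc 0 s)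

/-- The flow of `v` in time `s` exists near `x`, is differentiable at `x` and preserves the form `α`
there. -/
def FlowPreservesAt (v : ∀ x : N, TangentSpace J x) (α : DiffForm J N k) (s : ℝ) (x : N) : Prop :=
  ∃ Φ : N → N, (∀ᶠ z in 𝓝 x, FlowRel v s z (Φ z)) ∧ MDifferentiableAt J J Φ x ∧
    formPullback J J Φ α x = α x

theorem FlowRel.trans (hs : 0 ≤ s) (ht : 0 ≤ t) {x y z : N} (hxy : FlowRel v s x y)
    (hyz : FlowRel v t y z) : FlowRel v (s + t) x z := by
  obtain ⟨γ₁, rfl, rfl, h₁⟩ := hxy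
  obtain ⟨γ₂, h₂0, rfl, h₂⟩ := hyz
  have h₂' : IsMIntegralCurveOn (γ₂ ∘ (· - s)) v (Icc s (s + t)) :=
    (isMIntegralCurveOn_comp_sub (dt := s).2 h₂).mono
      fun r hr => ⟨by linarith [hr.1], by linarith [hr.2]⟩
  let γ : ℝ → N := fun r => if r ≤ s then γ₁ r else γ₂ (r - s)
  have hγ₁ : EqOn γ γ₁ (Icc 0 s) := fun r hr => if_pos hr.2
  have hγ₂ : EqOn γ (γ₂ ∘ (· - s)) (Icc s (s + t)) := fun r hr => by
    rcases hr.1.eq_or_lt with rfl | hlt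
    · simp [γ, h₂0]
    · simp [γ, not_le.2 hlt]
  exact ⟨γ, hγ₁ ⟨le_rfl, hs⟩, (hγ₂ ⟨by linarith, le_rfl⟩).trans (by simp),
    isMIntegralCurveOn_Icc_union hs (by linarith) (isMIntegralCurveOn_congr hγ₁ h₁)
      (isMIntegralCurveOn_congr hγ₂ h₂')⟩

theorem FlowPreservesAt.trans (hs : 0 ≤ s) (ht : 0 ≤ t) {α : DiffForm J N k} {x : N}
    (hx : FlowPreservesAt v α s x)
    (h : ∀ y, FlowRel v s x y → FlowPreservesAt v α t y) :
    FlowPreservesAt v α (s + t) x := by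
  obtain ⟨Φ, hΦ, hdΦ, hΦα⟩ := hx
  obtain ⟨Ψ, hΨ, hdΨ, hΨα⟩ := h (Φ x) hΦ.self_of_nhds
  refine ⟨Ψ ∘ Φ, ?_, hdΨ.comp x hdΦ, ?_⟩
  · filter_upwards [hΦ, hdΦ.continuousAt.eventually hΨ] with z hz hz'
    exact hz.trans hs ht hz'
  · rw [formPullback_comp α hdΨ hdΦ, ← hΦα]
    exact congrArg (fun β : F [⋀^Fin k]→L[ℝ] ℝ =>
      β.compContinuousLinearMap (modelDeriv J J Φ x)) hΨα

/-- In every preferred chart, the two-form `α` is the exterior derivative of a one-form `θ` whose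
Lie derivative `£_v θ` is exact. As `£_v` commutes with the exterior derivative, this is a way to
say that `£_v α = 0` without defining the Lie derivative on the manifold. -/
def HasInvariantPrimitives (v : ∀ x : N, TangentSpace J x) (α : DiffForm J N 2) : Prop :=
  ∀ x₀ : N, ∃ (θ : F → F →L[ℝ] ℝ) (l : F → ℝ),
    ContDiffOn ℝ 2 θ (extChartAt J x₀).target ∧ ContDiffOn ℝ 2 l (extChartAt J x₀).target ∧
    EqOn (lieDerivOneForm (chartField v x₀) θ) (fderiv ℝ l) (extChartAt J x₀).target ∧
    ∀ x ∈ (extChartAt J x₀).source,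
      α x = formPullback J 𝓘(ℝ, F) (extChartAt J x₀) (extDeriv (toOneForm θ)) x

theorem exists_pos_forall_mem_Icc_of_isCompact {X : Type*} [TopologicalSpace X] {K : Set X}
    (hK : IsCompact K) {P : ℝ → X → Prop}
    (h : ∀ x ∈ K, ∃ ε > 0, ∀ᶠ z in 𝓝 x, ∀ t ∈ Icc 0 ε, P t z) :
    ∃ ε > 0, ∀ z ∈ K, ∀ t ∈ Icc 0 ε, P t z := by
  refine hK.induction_on (p := fun S => ∃ ε > 0, ∀ z ∈ S, ∀ t ∈ Icc 0 ε, P t z)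
    ⟨1, one_pos, by simp⟩ ?_ ?_ ?_
  · rintro S S' hSS' ⟨ε, hε, hP⟩
    exact ⟨ε, hε, fun z hz => hP z (hSS' hz)⟩
  · rintro S S' ⟨ε, hε, hP⟩ ⟨ε', hε', hP'⟩
    refine ⟨min ε ε', lt_min hε hε', fun z hz t ht => hz.elim (fun hz => ?_) fun hz => ?_⟩
    · exact hP z hz t ⟨ht.1, ht.2.trans (min_le_left _ _)⟩
    · exact hP' z hz t ⟨ht.1, ht.2.trans (min_le_right _ _)⟩
  · intro z hz
    obtain ⟨ε, hε, hP⟩ := h z hz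
    exact ⟨_, mem_nhdsWithin_of_mem_nhds hP, ε, hε, fun z hz => hz⟩

variable [J.Boundaryless] [IsManifold J ∞ N]

theorem FlowRel.unique [T2Space N]
    (hv : ContMDiff J J.tangent ∞ fun x => (⟨x, v x⟩ : TangentBundle J N)) (hs : 0 ≤ s)
    {x y y' : N} (h : FlowRel v s x y) (h' : FlowRel v s x y') : y = y' := by
  obtain ⟨γ, h0, rfl, hγ⟩ := h
  obtain ⟨γ', h0', rfl, hγ'⟩ := h'
  exact isMIntegralCurveOn_Icc_eqOn hv hγ hγ' (h0.trans h0'.symm) ⟨hs, le_rfl⟩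

variable [CompleteSpace F] {α : DiffForm J N 2}

theorem HasInvariantPrimitives.exists_flowPreservesAt
    (hv : ContMDiff J J.tangent ∞ fun x => (⟨x, v x⟩ : TangentBundle J N))
    (hα : HasInvariantPrimitives v α) (x₀ : N) :
    ∃ ε > 0, ∀ᶠ x in 𝓝 x₀, ∀ s ∈ Icc 0 ε, FlowPreservesAt v α s x := by
  obtain ⟨θ, l, hθ, hl, hlie, hαθ⟩ := hα x₀
  let φ := extChartAt J x₀
  have hopen : IsOpen φ.target := isOpen_extChartAt_target x₀
  obtain ⟨ε, hε, U, hU, A, hA⟩ := exists_local_flow_formPullback_extDeriv_eq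
    (extChartAt_target_mem_nhds x₀)
    (fun y hy => (contDiffAt_chartField hv hy).of_le (WithTop.coe_le_coe.2 le_top))
    (fun y hy => hθ.contDiffAt (hopen.mem_nhds hy)) (fun y hy => hl.contDiffAt (hopen.mem_nhds hy))
    fun y hy => hlie.eventuallyEq_of_mem (hopen.mem_nhds hy)
  refine ⟨ε, hε, ?_⟩
  filter_upwards [(continuousAt_extChartAt (I := J) x₀).eventually
    (eventually_eventually_nhds.2 hU), extChartAt_source_mem_nhds (I := J) x₀] with x hxU hx s hs
  have hφ : MDifferentiableAt J 𝓘(ℝ, F) φ x := mdifferentiableAt_extChartAt_of_mem_source hx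
  have hnear : ∀ᶠ z in 𝓝 x, φ z ∈ U ∧ z ∈ φ.source :=
    (hφ.continuousAt.eventually hxU).and ((isOpen_extChartAt_source x₀).mem_nhds hx)
  obtain ⟨hAx, hdA, hAθ⟩ := (hA (φ x) hnear.self_of_nhds.1).2.2 s hs
  let Φ : N → N := φ.symm ∘ (A · s) ∘ φ
  have hΦx : Φ x ∈ φ.source := φ.map_target hAx
  have hdΦ : MDifferentiableAt J J Φ x :=
    (mdifferentiableAt_extChartAt_symm hAx).comp x (hdA.mdifferentiableAt.comp x hφ)
  refine ⟨Φ, ?_, hdΦ, ?_⟩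
  · filter_upwards [hnear] with z hz
    obtain ⟨hA0, hcurve, hflow⟩ := hA (φ z) hz.1
    have hsub : Icc 0 s ⊆ Icc 0 ε := Icc_subset_Icc_right hs.2
    refine ⟨φ.symm ∘ A (φ z), ?_, rfl, fun t ht => ?_⟩
    · rw [Function.comp_apply, hA0, φ.left_inv hz.2]
    · exact hasMFDerivWithinAt_extChartAt_symm_comp ((hcurve t (hsub ht)).mono hsub)
        (hflow t (hsub ht)).1
  · have hsemiconj : φ ∘ Φ =ᶠ[𝓝 x] (A · s) ∘ φ := by
      filter_upwards [hnear] with z hz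
      exact φ.right_inv ((hA (φ z) hz.1).2.2 s hs).1
    rw [hαθ x hx, ← formPullback_formPullback_eq_of_semiconj hsemiconj hdΦ
      (mdifferentiableAt_extChartAt_of_mem_source hΦx) hφ hdA.mdifferentiableAt hAθ]
    exact congrArg (fun β : F [⋀^Fin 2]→L[ℝ] ℝ =>
      β.compContinuousLinearMap (modelDeriv J J Φ x)) (hαθ (Φ x) hΦx)

theorem FlowRel.flowPreservesAt [T2Space N]
    (hv : ContMDiff J J.tangent ∞ fun x => (⟨x, v x⟩ : TangentBundle J N))
    (hα : HasInvariantPrimitives v α) (hs : 0 ≤ s) {x y : N} (h : FlowRel v s x y) :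
    FlowPreservesAt v α s x := by
  obtain ⟨γ, rfl, -, hγ⟩ := h
  obtain ⟨ε, hε, hshort⟩ := exists_pos_forall_mem_Icc_of_isCompact
    (isCompact_Icc.image_of_continuousOn hγ.continuousOn) fun z _ => hα.exists_flowPreservesAt hv z
  have hrel : ∀ r ∈ Icc 0 s, FlowRel v r (γ 0) (γ r) := fun r hr =>
    ⟨γ, rfl, rfl, hγ.mono (Icc_subset_Icc_right hr.2)⟩
  have hlong : ∀ n : ℕ, ∀ r ∈ Icc 0 s, r ≤ n * ε → FlowPreservesAt v α r (γ 0) := by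
    intro n
    induction n with
    | zero =>
      intro r hr hrn
      exact hshort (γ 0) ⟨0, ⟨le_rfl, hs⟩, rfl⟩ r ⟨hr.1, hrn.trans (by simpa using hε.le)⟩
    | succ n ih =>
      intro r hr hrn
      rcases le_or_gt r ε with hrε | hrε
      · exact hshort (γ 0) ⟨0, ⟨le_rfl, hs⟩, rfl⟩ r ⟨hr.1, hrε⟩
      · have hr' : r - ε ∈ Icc 0 s := ⟨by linarith, by linarith [hr.2]⟩
        rw [← sub_add_cancel r ε]
        refine (ih (r - ε) hr' (by push_cast at hrn; linarith)).trans hr'.1 hε.le fun y hy => ?_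
        rw [hy.unique hv hr'.1 (hrel _ hr')]
        exact hshort _ ⟨r - ε, hr', rfl⟩ ε ⟨hε.le, le_rfl⟩
  obtain ⟨n, hn⟩ := exists_nat_ge (s / ε)
  exact hlong n s ⟨hs, le_rfl⟩ ((div_le_iff₀ hε).1 hn)

end ManifoldFlow

section ChartBracket
variable {F : Type*} [NormedAddCommGroup F] [NormedSpace ℝ F]
  {HN : Type*} [TopologicalSpace HN] {J : ModelWithCorners ℝ F HN} [J.Boundaryless]
  {N : Type*} [TopologicalSpace N] [ChartedSpace HN N]

theorem mpullback_extChartAt_symm_eq_chartField [IsManifold J 1 N] (v : ∀ x : N, TangentSpace J x)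
    {x₀ : N} {y : F} (hy : y ∈ (extChartAt J x₀).target) :
    VectorField.mpullback 𝓘(ℝ, F) J (extChartAt J x₀).symm v y = chartField v x₀ y := by
  have hinv : (modelDeriv 𝓘(ℝ, F) J (extChartAt J x₀).symm y).inverse =
      modelDeriv J 𝓘(ℝ, F) (extChartAt J x₀) ((extChartAt J x₀).symm y) :=
    ContinuousLinearMap.inverse_eq
      (ContinuousLinearMap.ext (modelDeriv_extChartAt_symm_modelDeriv_extChartAt hy))
      (ContinuousLinearMap.ext (modelDeriv_extChartAt_modelDeriv_extChartAt_symm hy))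
  exact congrArg (fun A : F →L[ℝ] F => A (v ((extChartAt J x₀).symm y))) hinv

theorem mlieBracket_modelSpace_eq_lieBracket (v w : F → F) :
    VectorField.mlieBracket 𝓘(ℝ, F) v w = VectorField.lieBracket ℝ v w :=
  VectorField.mlieBracketWithin_univ.symm.trans <|
    VectorField.mlieBracketWithin_eq_lieBracketWithin.trans VectorField.lieBracketWithin_univ

theorem chartField_mlieBracket [CompleteSpace F] [IsManifold J 2 N]
    {v w : ∀ x : N, TangentSpace J x} {x₀ : N} {y : F} (hy : y ∈ (extChartAt J x₀).target)
    (hv : MDifferentiableAt J J.tangent (fun x => (⟨x, v x⟩ : TangentBundle J N))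
      ((extChartAt J x₀).symm y))
    (hw : MDifferentiableAt J J.tangent (fun x => (⟨x, w x⟩ : TangentBundle J N))
      ((extChartAt J x₀).symm y)) :
    chartField (VectorField.mlieBracket J v w) x₀ y =
      VectorField.lieBracket ℝ (chartField v x₀) (chartField w x₀) y := by
  have : IsManifold J 1 N := IsManifold.of_le one_le_two
  have : IsManifold J (minSmoothness ℝ 2) N := by
    rwa [minSmoothness_of_isRCLikeNormedField]
  have hpullback : ∀ u : ∀ x : N, TangentSpace J x,
      VectorField.mpullback 𝓘(ℝ, F) J (extChartAt J x₀).symm u =ᶠ[𝓝 y] chartField u x₀ := fun u =>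
    Filter.eventuallyEq_of_mem ((isOpen_extChartAt_target x₀).mem_nhds hy)
      fun _ => mpullback_extChartAt_symm_eq_chartField u
  rw [← mpullback_extChartAt_symm_eq_chartField _ hy, VectorField.mpullback_mlieBracket hv hw
    (contMDiffAt_extChartAt_symm hy) minSmoothness_of_isRCLikeNormedField.le,
    (hpullback v).mlieBracket_vectorField_eq (hpullback w)]
  exact congrFun (mlieBracket_modelSpace_eq_lieBracket _ _) y

end ChartBracket

section GroupCoordinates
variable {E : Type*} [NormedAddCommGroup E] [NormedSpace ℝ E]
  {H : Type*} [TopologicalSpace H] {I : ModelWithCorners ℝ E H}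
  {G : Type*} [TopologicalSpace G] [ChartedSpace H G] [Group G]

variable (I) in
/-- The left-invariant vector fields in the preferred chart at `g₀`: `leftFrame I g₀ q ξ` represents
the vector field `g ↦ g ξ` at the point with coordinates `q`. -/
def leftFrame (g₀ : G) (q : E) : E →L[ℝ] E :=
  (modelDeriv I 𝓘(ℝ, E) (extChartAt I g₀) ((extChartAt I g₀).symm q)).comp
    (leftMul I ((extChartAt I g₀).symm q))

variable (I) in
/-- The coframe dual to `leftFrame`, that is, the left Maurer–Cartan form in the preferred chart
at `g₀`. -/
def leftCoframe (g₀ : G) (q : E) : E →L[ℝ] E := (leftFrame I g₀ q).inverse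

theorem leftFrame_extChartAt {g₀ g : G} (hg : g ∈ (extChartAt I g₀).source) (ξ : E) :
    leftFrame I g₀ (extChartAt I g₀ g) ξ =
      modelDeriv I 𝓘(ℝ, E) (extChartAt I g₀) g (leftMul I g ξ) :=
  chartField_extChartAt (fun g => leftMul I g ξ) hg

variable [LieGroup I ∞ G] [I.Boundaryless]

theorem isInvertible_leftFrame {g₀ : G} {q : E} (hq : q ∈ (extChartAt I g₀).target) :
    (leftFrame I g₀ q).IsInvertible := by
  have : IsManifold I 1 G := IsManifold.of_le (n := ∞) (by simp)
  let mulInv : E →L[ℝ] E := leftMulInv I ((extChartAt I g₀).symm q)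
  refine ContinuousLinearMap.IsInvertible.of_inverse
    (g := mulInv.comp (modelDeriv 𝓘(ℝ, E) I (extChartAt I g₀).symm q))
    (ContinuousLinearMap.ext fun w => ?_) (ContinuousLinearMap.ext fun ξ => ?_)
  · exact (congrArg _ (leftMul_leftMulInv _ _)).trans
      (modelDeriv_extChartAt_modelDeriv_extChartAt_symm hq w)
  · exact (congrArg mulInv
      (modelDeriv_extChartAt_symm_modelDeriv_extChartAt hq _)).trans (leftMulInv_leftMul _ ξ)

theorem leftCoframe_leftFrame {g₀ : G} {q : E} (hq : q ∈ (extChartAt I g₀).target) (ξ : E) :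
    leftCoframe I g₀ q (leftFrame I g₀ q ξ) = ξ :=
  (isInvertible_leftFrame hq).inverse_apply_self ξ

theorem leftFrame_leftCoframe {g₀ : G} {q : E} (hq : q ∈ (extChartAt I g₀).target) (w : E) :
    leftFrame I g₀ q (leftCoframe I g₀ q w) = w :=
  (isInvertible_leftFrame hq).self_apply_inverse w

theorem leftCoframe_extChartAt {g₀ g : G} (hg : g ∈ (extChartAt I g₀).source)
    (v : TangentSpace I g) :
    leftCoframe I g₀ (extChartAt I g₀ g) (modelDeriv I 𝓘(ℝ, E) (extChartAt I g₀) g v) =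
      leftMulInv I g v := by
  have h : modelDeriv I 𝓘(ℝ, E) (extChartAt I g₀) g v =
      leftFrame I g₀ (extChartAt I g₀ g) (leftMulInv I g v) :=
    (congrArg (modelDeriv I 𝓘(ℝ, E) (extChartAt I g₀) g) (leftMul_leftMulInv g v)).symm.trans
      (leftFrame_extChartAt hg _).symm
  rw [h]
  exact leftCoframe_leftFrame ((extChartAt I g₀).map_source hg) _

variable [FiniteDimensional ℝ E]

theorem contDiffOn_leftFrame (g₀ : G) :
    ContDiffOn ℝ ∞ (leftFrame I g₀) (extChartAt I g₀).target :=
  contDiffOn_clm_apply.2 fun ξ => contMDiff_iff_contDiffOn_chartField.1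
    (contMDiff_leftMul.comp (contMDiff_id.prodMk (contMDiff_const (c := ξ)))) g₀

theorem contDiffOn_leftCoframe (g₀ : G) :
    ContDiffOn ℝ ∞ (leftCoframe I g₀) (extChartAt I g₀).target := fun q hq =>
  have : CompleteSpace E := FiniteDimensional.complete ℝ E
  (isInvertible_leftFrame hq).contDiffAt_map_inverse.comp_contDiffWithinAt q
    (contDiffOn_leftFrame g₀ q hq)

theorem differentiableAt_leftFrame {g₀ : G} {q : E} (hq : q ∈ (extChartAt I g₀).target) :
    DifferentiableAt ℝ (leftFrame I g₀) q :=
  ((contDiffOn_leftFrame g₀).contDiffAt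
    ((isOpen_extChartAt_target g₀).mem_nhds hq)).differentiableAt (by simp)

theorem differentiableAt_leftCoframe {g₀ : G} {q : E} (hq : q ∈ (extChartAt I g₀).target) :
    DifferentiableAt ℝ (leftCoframe I g₀) q :=
  ((contDiffOn_leftCoframe g₀).contDiffAt
    ((isOpen_extChartAt_target g₀).mem_nhds hq)).differentiableAt (by simp)

theorem fderiv_leftCoframe_leftFrame {g₀ : G} {q : E} (hq : q ∈ (extChartAt I g₀).target)
    (u ξ : E) :
    fderiv ℝ (leftCoframe I g₀) q u (leftFrame I g₀ q ξ) =
      -leftCoframe I g₀ q (fderiv ℝ (leftFrame I g₀) q u ξ) := by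
  have hprod := (differentiableAt_leftCoframe hq).hasFDerivAt.clm_apply
    ((differentiableAt_leftFrame hq).hasFDerivAt.clm_apply (hasFDerivAt_const ξ q))
  have hconst : HasFDerivAt (fun q => leftCoframe I g₀ q (leftFrame I g₀ q ξ)) (0 : E →L[ℝ] E) q :=
    (hasFDerivAt_const ξ q).congr_of_eventuallyEq <|
      Filter.eventuallyEq_of_mem ((isOpen_extChartAt_target g₀).mem_nhds hq)
        fun _ hq' => leftCoframe_leftFrame hq' ξ
  have h := congrArg (fun A : E →L[ℝ] E => A u) (hprod.unique hconst)
  rw [eq_neg_iff_add_eq_zero, add_comm]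
  simpa using h

theorem leftFrame_bracket {g₀ : G} {q : E} (hq : q ∈ (extChartAt I g₀).target)
    (ξ η : GroupLieAlgebra I G) :
    leftFrame I g₀ q (⁅ξ, η⁆ : GroupLieAlgebra I G) =
      fderiv ℝ (leftFrame I g₀) q (leftFrame I g₀ q ξ) η -
        fderiv ℝ (leftFrame I g₀) q (leftFrame I g₀ q η) ξ := by
  have : CompleteSpace E := FiniteDimensional.complete ℝ E
  have : IsManifold I 2 G := IsManifold.of_le (n := ∞) (WithTop.coe_le_coe.2 le_top)
  have : LieGroup I (minSmoothness ℝ 3) G := by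
    rw [minSmoothness_of_isRCLikeNormedField]; infer_instance
  have hfderiv : ∀ ζ u : E, fderiv ℝ (fun q => leftFrame I g₀ q ζ) q u =
      fderiv ℝ (leftFrame I g₀) q u ζ := fun ζ u => by
    simp [((differentiableAt_leftFrame hq).hasFDerivAt.clm_apply (hasFDerivAt_const ζ q)).fderiv]
  have hbracket := chartField_mlieBracket hq (mdifferentiableAt_mulInvariantVectorField ξ)
    (mdifferentiableAt_mulInvariantVectorField η)
  rw [← mulInvariantVector_mlieBracket] at hbracket
  exact hbracket.trans (congrArg₂ (· - ·) (hfderiv η _) (hfderiv ξ _))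

end GroupCoordinates

section ProductCharts
variable {E : Type*} [NormedAddCommGroup E] [NormedSpace ℝ E]
  {H : Type*} [TopologicalSpace H] {I : ModelWithCorners ℝ E H}
  {G : Type*} [TopologicalSpace G] [ChartedSpace H G]
  {V : Type*} [NormedAddCommGroup V] [NormedSpace ℝ V]

theorem extChartAt_prod_modelSpace_target (n₀ : G × V) :
    (extChartAt (I.prod 𝓘(ℝ, V)) n₀).target = (extChartAt I n₀.1).target ×ˢ univ := by
  rw [extChartAt_prod, PartialEquiv.prod_target, extChartAt_model_space_eq_id,
    PartialEquiv.refl_target]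

theorem extChartAt_prod_modelSpace_source (n₀ : G × V) :
    (extChartAt (I.prod 𝓘(ℝ, V)) n₀).source = (extChartAt I n₀.1).source ×ˢ univ := by
  rw [extChartAt_prod, PartialEquiv.prod_source, extChartAt_model_space_eq_id,
    PartialEquiv.refl_source]

theorem modelDeriv_extChartAt_prod_modelSpace [IsManifold I 1 G] {n₀ n : G × V}
    (hn : n.1 ∈ (extChartAt I n₀.1).source) (w : E × V) :
    modelDeriv (I.prod 𝓘(ℝ, V)) 𝓘(ℝ, E × V) (extChartAt (I.prod 𝓘(ℝ, V)) n₀) n w =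
      (modelDeriv I 𝓘(ℝ, E) (extChartAt I n₀.1) n.1 w.1, w.2) := by
  have hfst := (mdifferentiableAt_extChartAt_of_mem_source hn).hasMFDerivAt.comp n
    (hasMFDerivAt_fst (I := I) (I' := 𝓘(ℝ, V)) n)
  have hsnd := hasMFDerivAt_snd (I := I) (I' := 𝓘(ℝ, V)) n
  have h : HasMFDerivAt (I.prod 𝓘(ℝ, V)) 𝓘(ℝ, E × V) (extChartAt (I.prod 𝓘(ℝ, V)) n₀) n
      (((modelDeriv I 𝓘(ℝ, E) (extChartAt I n₀.1) n.1).comp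
        (ContinuousLinearMap.fst ℝ E V)).prod (ContinuousLinearMap.snd ℝ E V)) :=
    ⟨hfst.1.prodMk hsnd.1, hfst.2.prodMk hsnd.2⟩
  exact congrArg (fun A : E × V →L[ℝ] E × V => A w) h.mfderiv

end ProductCharts

section MomentumOneForm
variable {E : Type*} [NormedAddCommGroup E] [NormedSpace ℝ E]
  {H : Type*} [TopologicalSpace H] {I : ModelWithCorners ℝ E H}
  {G : Type*} [TopologicalSpace G] [ChartedSpace H G] [Group G]

variable (I) in
/-- The canonical one-form of `T*G` in the left trivialization and in the preferred chart at `g₀`: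
in the variables `(q, μ)` it is the pairing of `μ` with the Maurer–Cartan form. -/
def momentumOneForm (g₀ : G) (y : E × (E →L[ℝ] ℝ)) : E × (E →L[ℝ] ℝ) →L[ℝ] ℝ :=
  (y.2.comp (leftCoframe I g₀ y.1)).comp (ContinuousLinearMap.fst ℝ E (E →L[ℝ] ℝ))

theorem momentumOneForm_apply (g₀ : G) (y u : E × (E →L[ℝ] ℝ)) :
    momentumOneForm I g₀ y u = y.2 (leftCoframe I g₀ y.1 u.1) := rfl

variable [LieGroup I ∞ G] [I.Boundaryless] [FiniteDimensional ℝ E]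

theorem contDiffOn_momentumOneForm (g₀ : G) :
    ContDiffOn ℝ ∞ (momentumOneForm I g₀) ((extChartAt I g₀).target ×ˢ univ) :=
  (contDiffOn_snd.clm_comp ((contDiffOn_leftCoframe g₀).comp contDiffOn_fst fun _ hy =>
    hy.1)).clm_comp contDiffOn_const

theorem differentiableAt_momentumOneForm {g₀ : G} {y : E × (E →L[ℝ] ℝ)}
    (hy : y.1 ∈ (extChartAt I g₀).target) : DifferentiableAt ℝ (momentumOneForm I g₀) y :=
  ((contDiffOn_momentumOneForm g₀).contDiffAt
    (((isOpen_extChartAt_target g₀).prod isOpen_univ).mem_nhds ⟨hy, trivial⟩)).differentiableAt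
    (by simp)

theorem fderiv_momentumOneForm {g₀ : G} {y : E × (E →L[ℝ] ℝ)}
    (hy : y.1 ∈ (extChartAt I g₀).target) (w u : E × (E →L[ℝ] ℝ)) :
    fderiv ℝ (momentumOneForm I g₀) y w u =
      w.2 (leftCoframe I g₀ y.1 u.1) + y.2 (fderiv ℝ (leftCoframe I g₀) y.1 w.1 u.1) := by
  have hcoframe : HasFDerivAt (fun z : E × (E →L[ℝ] ℝ) => leftCoframe I g₀ z.1) _ y :=
    (differentiableAt_leftCoframe hy).hasFDerivAt.comp y hasFDerivAt_fst
  have hpairing : HasFDerivAt (fun z : E × (E →L[ℝ] ℝ) => z.2 (leftCoframe I g₀ z.1 u.1)) _ y :=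
    hasFDerivAt_snd.clm_apply (hcoframe.clm_apply (hasFDerivAt_const u.1 y))
  have happly := (differentiableAt_momentumOneForm hy).hasFDerivAt.clm_apply (hasFDerivAt_const u y)
  simpa [add_comm] using DFunLike.congr_fun (happly.unique hpairing) w

theorem lieDerivOneForm_momentumOneForm {g₀ : G} {ξ : E × (E →L[ℝ] ℝ) → E}
    {m : E × (E →L[ℝ] ℝ) → E →L[ℝ] ℝ} {y : E × (E →L[ℝ] ℝ)}
    (hy : y.1 ∈ (extChartAt I g₀).target) (hξ : DifferentiableAt ℝ ξ y)
    (hm : DifferentiableAt ℝ m y) (η : E) (ν : E →L[ℝ] ℝ) :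
    lieDerivOneForm (fun z => (leftFrame I g₀ z.1 (ξ z), m z)) (momentumOneForm I g₀) y
        (leftFrame I g₀ y.1 η, ν) =
      m y η - coad (I := I) (G := G) (ξ y) y.2 η +
        y.2 (fderiv ℝ ξ y (leftFrame I g₀ y.1 η, ν)) := by
  have hframe : HasFDerivAt (fun z : E × (E →L[ℝ] ℝ) => leftFrame I g₀ z.1) _ y :=
    (differentiableAt_leftFrame hy).hasFDerivAt.comp y hasFDerivAt_fst
  have hfield : fderiv ℝ (fun z => (leftFrame I g₀ z.1 (ξ z), m z)) y (leftFrame I g₀ y.1 η, ν) =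
      (leftFrame I g₀ y.1 (fderiv ℝ ξ y (leftFrame I g₀ y.1 η, ν)) +
          fderiv ℝ (leftFrame I g₀) y.1 (leftFrame I g₀ y.1 η) (ξ y),
        fderiv ℝ m y (leftFrame I g₀ y.1 η, ν)) := by
    rw [((hframe.clm_apply hξ.hasFDerivAt).prodMk hm.hasFDerivAt).fderiv]
    rfl
  have hbracket : coad (I := I) (G := G) (ξ y) y.2 η =
      y.2 (leftCoframe I g₀ y.1 (fderiv ℝ (leftFrame I g₀) y.1 (leftFrame I g₀ y.1 (ξ y)) η)) -
        y.2 (leftCoframe I g₀ y.1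
          (fderiv ℝ (leftFrame I g₀) y.1 (leftFrame I g₀ y.1 η) (ξ y))) := by
    rw [← map_sub, ← map_sub]
    exact congrArg y.2 ((leftCoframe_leftFrame hy _).symm.trans
      (congrArg (leftCoframe I g₀ y.1) (leftFrame_bracket hy (ξ y) η)))
  rw [lieDerivOneForm, add_apply, ContinuousLinearMap.comp_apply, hfield,
    fderiv_momentumOneForm hy, momentumOneForm_apply]
  dsimp only
  rw [fderiv_leftCoframe_leftFrame hy, leftCoframe_leftFrame hy, map_add (leftCoframe I g₀ y.1),
    leftCoframe_leftFrame hy, map_add, map_neg]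
  linear_combination hbracket

end MomentumOneForm

section SmoothOperators
variable {E : Type*} [NormedAddCommGroup E] [NormedSpace ℝ E] [FiniteDimensional ℝ E]
  {V : Type*} [NormedAddCommGroup V] [NormedSpace ℝ V]
  {F : Type*} [NormedAddCommGroup F] [NormedSpace ℝ F]
  {HM : Type*} [TopologicalSpace HM] {J : ModelWithCorners ℝ F HM}
  {M : Type*} [TopologicalSpace M] [ChartedSpace HM M]

theorem contMDiff_clm_of_apply {n : WithTop ℕ∞} {f : M → E →L[ℝ] V}
    (hf : ∀ η, ContMDiff J 𝓘(ℝ, V) n fun x => f x η) : ContMDiff J 𝓘(ℝ, E →L[ℝ] V) n f := by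
  let b := Module.finBasis ℝ E
  let single i : V →L[ℝ] E →L[ℝ] V :=
    ContinuousLinearMap.smulRightL ℝ E V (LinearMap.toContinuousLinearMap (b.coord i))
  have hsum : f = fun x => ∑ i, single i (f x (b i)) := by
    ext x η
    rw [sum_apply]
    conv_lhs => rw [← b.sum_repr η, map_sum]
    exact Finset.sum_congr rfl fun i _ => map_smul (f x) _ _
  rw [hsum]
  exact contMDiff_finsetSum fun i _ => (single i).contMDiff.comp (hf (b i))

end SmoothOperators

section Cotangent
variable {E : Type*} [NormedAddCommGroup E] [NormedSpace ℝ E]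
  {H : Type*} [TopologicalSpace H] {I : ModelWithCorners ℝ E H}
  {G : Type*} [TopologicalSpace G] [ChartedSpace H G] [Group G]

variable (I G) in
/-- The left trivialization `(g, μ) ↦ (g, g μ)` of the cotangent bundle. -/
def cotangentOfMomentum (n : G × (E →L[ℝ] ℝ)) : CotangentBundle I G :=
  ⟨n.1, ContinuousLinearMap.comp n.2 (leftMulInv I n.1)⟩

variable (I G) in
/-- The inverse `(g, p) ↦ (g, g⁻¹ p)` of the left trivialization of the cotangent bundle. -/
def momentumOfCotangent (z : CotangentBundle I G) : G × (E →L[ℝ] ℝ) :=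
  (z.1, ContinuousLinearMap.comp z.2 (leftMul I z.1))

variable [LieGroup I ∞ G]

theorem momentumOfCotangent_cotangentOfMomentum :
    Function.LeftInverse (momentumOfCotangent I G) (cotangentOfMomentum I G) := fun n =>
  Prod.ext rfl (ContinuousLinearMap.ext fun η => congrArg n.2 (leftMulInv_leftMul (I := I) n.1 η))

theorem contMDiff_cotangentOfMomentum :
    ContMDiff (I.prod 𝓘(ℝ, E →L[ℝ] ℝ)) (I.prod 𝓘(ℝ, E →L[ℝ] ℝ)) ∞ (cotangentOfMomentum I G) :=
  contMDiff_coMul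

theorem contMDiff_momentumOfCotangent [FiniteDimensional ℝ E] :
    ContMDiff (I.prod 𝓘(ℝ, E →L[ℝ] ℝ)) (I.prod 𝓘(ℝ, E →L[ℝ] ℝ)) ∞
      (momentumOfCotangent I G) := by
  have hproj : ContMDiff (I.prod 𝓘(ℝ, E →L[ℝ] ℝ)) I ∞ (fun z : CotangentBundle I G => z.1) :=
    contMDiff_proj _
  refine hproj.prodMk (contMDiff_clm_of_apply fun η z₀ => ?_)
  have hvector : ContMDiff (I.prod 𝓘(ℝ, E →L[ℝ] ℝ)) I.tangent ∞
      (fun z : CotangentBundle I G => (⟨z.1, leftMul I z.1 η⟩ : TangentBundle I G)) :=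
    contMDiff_leftMul.comp (hproj.prodMk contMDiff_const)
  have hpairing := ContMDiffAt.clm_bundle_apply (E₂ := fun _ : G => ℝ) (F₂ := ℝ)
    (b := fun z : CotangentBundle I G => z.1) (ϕ := fun z : CotangentBundle I G => z.2)
    (v := fun z => leftMul I z.1 η) contMDiffAt_id (hvector z₀)
  exact (contMDiffAt_totalSpace.1 hpairing).2

end Cotangent

section Legendre
variable {E : Type*} [NormedAddCommGroup E] [NormedSpace ℝ E]
  {H : Type*} [TopologicalSpace H] {I : ModelWithCorners ℝ E H}
  {G : Type*} [TopologicalSpace G] [ChartedSpace H G] [Group G] [LieGroup I ∞ G]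

theorem legendreTransform_leftMul (L : Lagrangian I G) (g : G) (ξ : E) :
    legendreTransform L ⟨g, leftMul I g ξ⟩ = cotangentOfMomentum I G (g, dLagrangian_dξ L g ξ) := by
  rw [legendreTransform, fiberDerivative_eq, cotangentOfMomentum]

/-- `ξ = X (g, μ)` is the smooth solution of `μ = ∂ℓ/∂ξ (g, ξ)`: the inverse of the Legendre
transform in the left trivialization. -/
structure IsLegendreInverse (L : Lagrangian I G) (X : G × (E →L[ℝ] ℝ) → E) : Prop where
  contMDiff : ContMDiff (I.prod 𝓘(ℝ, E →L[ℝ] ℝ)) 𝓘(ℝ, E) ∞ X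
  right_inv : ∀ n, dLagrangian_dξ L n.1 (X n) = n.2
  left_inv : ∀ g ξ, X (g, dLagrangian_dξ L g ξ) = ξ

theorem Hyperregular.exists_isLegendreInverse {L : Lagrangian I G} (hL : Hyperregular L) :
    ∃ X, IsLegendreInverse L X := by
  obtain ⟨Φ, hΦ⟩ := hL
  let velocity : TangentBundle I G → G × E := fun z => (z.1, leftMulInv I z.1 z.2)
  let state n := Φ.symm (cotangentOfMomentum I G n)
  have hvelocity : ContMDiff (I.prod 𝓘(ℝ, E →L[ℝ] ℝ)) (I.prod 𝓘(ℝ, E)) ∞ (velocity ∘ state) :=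
    contMDiff_leftMulInv.comp (Φ.symm.contMDiff.comp contMDiff_cotangentOfMomentum)
  refine ⟨fun n => (velocity (state n)).2, hvelocity.snd, fun n => ?_, fun g ξ => ?_⟩
  · have hstate : (⟨(state n).1, leftMul I (state n).1 (velocity (state n)).2⟩ :
        TangentBundle I G) = state n :=
      congrArg (TotalSpace.mk (state n).1) (leftMul_leftMulInv _ _)
    have hn : ((state n).1, dLagrangian_dξ L (state n).1 (velocity (state n)).2) = n := by
      refine (momentumOfCotangent_cotangentOfMomentum (I := I)).injective ?_
      rw [← legendreTransform_leftMul, hstate, ← hΦ, Φ.apply_symm_apply]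
    exact (congrArg (dLagrangian_dξ L · _) (congrArg Prod.fst hn).symm).trans
      (congrArg Prod.snd hn)
  · have hstate : state (g, dLagrangian_dξ L g ξ) = ⟨g, leftMul I g ξ⟩ :=
      Φ.toEquiv.symm_apply_eq.2 ((hΦ _).trans (legendreTransform_leftMul L g ξ)).symm
    exact (congrArg (fun z => (velocity z).2) hstate).trans (leftMulInv_leftMul g ξ)

end Legendre

section CanonicalForm
variable {E : Type*} [NormedAddCommGroup E] [NormedSpace ℝ E] [FiniteDimensional ℝ E]
  {H : Type*} [TopologicalSpace H] {I : ModelWithCorners ℝ E H}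
  {G : Type*} [TopologicalSpace G] [ChartedSpace H G] [Group G] [LieGroup I ∞ G]

theorem modelDeriv_momentumOfCotangent_fst (z : CotangentBundle I G) (w : E × (E →L[ℝ] ℝ)) :
    (modelDeriv (I.prod 𝓘(ℝ, E →L[ℝ] ℝ)) (I.prod 𝓘(ℝ, E →L[ℝ] ℝ)) (momentumOfCotangent I G) z w).1 =
      modelDeriv (I.prod 𝓘(ℝ, E →L[ℝ] ℝ)) I (TotalSpace.proj : CotangentBundle I G → G) z w := by
  have hm : MDifferentiableAt (I.prod 𝓘(ℝ, E →L[ℝ] ℝ)) (I.prod 𝓘(ℝ, E →L[ℝ] ℝ))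
      (momentumOfCotangent I G) z := contMDiff_momentumOfCotangent.mdifferentiableAt (by simp)
  have hproj := (hasMFDerivAt_fst (I := I) (I' := 𝓘(ℝ, E →L[ℝ] ℝ))
    (momentumOfCotangent I G z)).comp z hm.hasMFDerivAt
  exact (congrArg (fun A : E × (E →L[ℝ] ℝ) →L[ℝ] E => A w) hproj.mfderiv).symm

theorem contMDiffAt_extChartAt_comp_momentumOfCotangent {n₀ : G × (E →L[ℝ] ℝ)}
    {z : CotangentBundle I G} (hz : z.1 ∈ (extChartAt I n₀.1).source) :
    ContMDiffAt (I.prod 𝓘(ℝ, E →L[ℝ] ℝ)) 𝓘(ℝ, E × (E →L[ℝ] ℝ)) ∞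
      (extChartAt (I.prod 𝓘(ℝ, E →L[ℝ] ℝ)) n₀ ∘ momentumOfCotangent I G) z := by
  refine ContMDiffAt.comp z (contMDiffAt_extChartAt' ?_)
    contMDiff_momentumOfCotangent.contMDiffAt
  rw [← extChartAt_source (I.prod 𝓘(ℝ, E →L[ℝ] ℝ)), extChartAt_prod_modelSpace_source]
  exact ⟨hz, trivial⟩

variable [I.Boundaryless]

theorem canonicalOneForm_eq_formPullback {n₀ : G × (E →L[ℝ] ℝ)} {z : CotangentBundle I G}
    (hz : z.1 ∈ (extChartAt I n₀.1).source) :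
    canonicalOneForm I G z =
      formPullback (I.prod 𝓘(ℝ, E →L[ℝ] ℝ)) 𝓘(ℝ, E × (E →L[ℝ] ℝ))
        (extChartAt (I.prod 𝓘(ℝ, E →L[ℝ] ℝ)) n₀ ∘ momentumOfCotangent I G)
        (toOneForm (momentumOneForm I n₀.1)) z := by
  have : IsManifold I 1 G := IsManifold.of_le (n := ∞) (by simp)
  let c := extChartAt (I.prod 𝓘(ℝ, E →L[ℝ] ℝ)) n₀
  let p : E →L[ℝ] ℝ := z.2
  have hc : MDifferentiableAt (I.prod 𝓘(ℝ, E →L[ℝ] ℝ)) 𝓘(ℝ, E × (E →L[ℝ] ℝ)) c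
      (momentumOfCotangent I G z) := mdifferentiableAt_extChartAt_of_mem_source (by
    rw [extChartAt_prod_modelSpace_source]
    exact ⟨hz, trivial⟩)
  refine ContinuousAlternatingMap.ext fun w : Fin 1 → E × (E →L[ℝ] ℝ) => ?_
  let v : E := modelDeriv (I.prod 𝓘(ℝ, E →L[ℝ] ℝ)) I
    (TotalSpace.proj : CotangentBundle I G → G) z (w 0)
  have hv : (modelDeriv (I.prod 𝓘(ℝ, E →L[ℝ] ℝ)) 𝓘(ℝ, E × (E →L[ℝ] ℝ))
      (c ∘ momentumOfCotangent I G) z (w 0)).1 =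
        modelDeriv I 𝓘(ℝ, E) (extChartAt I n₀.1) z.1 v := by
    rw [modelDeriv_comp hc (contMDiff_momentumOfCotangent.mdifferentiableAt (by simp)),
      ContinuousLinearMap.comp_apply, modelDeriv_extChartAt_prod_modelSpace hz,
      modelDeriv_momentumOfCotangent_fst]
    rfl
  have hcoframe : momentumOneForm I n₀.1 (c (momentumOfCotangent I G z))
      (modelDeriv (I.prod 𝓘(ℝ, E →L[ℝ] ℝ)) 𝓘(ℝ, E × (E →L[ℝ] ℝ))
        (c ∘ momentumOfCotangent I G) z (w 0)) = p (leftMul I z.1 (leftMulInv I z.1 v)) := by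
    rw [momentumOneForm_apply, hv]
    exact congrArg (fun η : E => p (leftMul I z.1 η)) (leftCoframe_extChartAt hz v)
  exact (hcoframe.trans (congrArg p (leftMul_leftMulInv (I := I) z.1 v))).symm

theorem canonicalTwoForm_eq_formPullback {n₀ : G × (E →L[ℝ] ℝ)} {z : CotangentBundle I G}
    (hz : z.1 ∈ (extChartAt I n₀.1).source) :
    canonicalTwoForm I G z =
      formPullback (I.prod 𝓘(ℝ, E →L[ℝ] ℝ)) 𝓘(ℝ, E × (E →L[ℝ] ℝ))
        (extChartAt (I.prod 𝓘(ℝ, E →L[ℝ] ℝ)) n₀ ∘ momentumOfCotangent I G)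
        (extDeriv (toOneForm (momentumOneForm I n₀.1))) z := by
  have : IsManifold (I.prod 𝓘(ℝ, E →L[ℝ] ℝ)) 2 (CotangentBundle I G) :=
    IsManifold.of_le (n := ∞) (WithTop.coe_le_coe.2 le_top)
  have hθ : DifferentiableAt ℝ (momentumOneForm I n₀.1)
      (extChartAt (I.prod 𝓘(ℝ, E →L[ℝ] ℝ)) n₀ (momentumOfCotangent I G z)) :=
    differentiableAt_momentumOneForm ((extChartAt I n₀.1).map_source hz)
  refine exteriorDerivative_eq_of_eventually_formPullback
    ((contMDiffAt_extChartAt_comp_momentumOfCotangent hz).of_le (WithTop.coe_le_coe.2 le_top))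
    (differentiableAt_toOneForm hθ) ?_
  filter_upwards [((isOpen_extChartAt_source (I := I) n₀.1).preimage
    (FiberBundle.continuous_proj _ _)).mem_nhds (show z ∈ _ from hz)] with z' hz'
  exact canonicalOneForm_eq_formPullback hz'

variable (I G) in
/-- The canonical symplectic form of `T*G` in the left trivialization `G × 𝔤*`. -/
def momentumTwoForm : DiffForm (I.prod 𝓘(ℝ, E →L[ℝ] ℝ)) (G × (E →L[ℝ] ℝ)) 2 :=
  formPullback (I.prod 𝓘(ℝ, E →L[ℝ] ℝ)) (I.prod 𝓘(ℝ, E →L[ℝ] ℝ)) (cotangentOfMomentum I G)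
    (canonicalTwoForm I G)

theorem momentumTwoForm_eq_formPullback {n₀ n : G × (E →L[ℝ] ℝ)}
    (hn : n.1 ∈ (extChartAt I n₀.1).source) :
    momentumTwoForm I G n =
      formPullback (I.prod 𝓘(ℝ, E →L[ℝ] ℝ)) 𝓘(ℝ, E × (E →L[ℝ] ℝ))
        (extChartAt (I.prod 𝓘(ℝ, E →L[ℝ] ℝ)) n₀)
        (extDeriv (toOneForm (momentumOneForm I n₀.1))) n := by
  let c := extChartAt (I.prod 𝓘(ℝ, E →L[ℝ] ℝ)) n₀
  let z := cotangentOfMomentum I G n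
  have hz : z.1 ∈ (extChartAt I n₀.1).source := hn
  have hc : (c ∘ momentumOfCotangent I G) ∘ cotangentOfMomentum I G = c :=
    funext fun n' => congrArg c (momentumOfCotangent_cotangentOfMomentum n')
  have hΨ : MDifferentiableAt (I.prod 𝓘(ℝ, E →L[ℝ] ℝ)) (I.prod 𝓘(ℝ, E →L[ℝ] ℝ))
      (cotangentOfMomentum I G) n := contMDiff_cotangentOfMomentum.mdifferentiableAt (by simp)
  have hcomp := formPullback_comp (f := cotangentOfMomentum I G) (x := n)
    (g := c ∘ momentumOfCotangent I G) (extDeriv (toOneForm (momentumOneForm I n₀.1)))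
    ((contMDiffAt_extChartAt_comp_momentumOfCotangent hz).mdifferentiableAt (by simp)) hΨ
  rw [hc] at hcomp
  refine Eq.trans ?_ hcomp.symm
  exact congrArg (fun β : (E × (E →L[ℝ] ℝ)) [⋀^Fin 2]→L[ℝ] ℝ => β.compContinuousLinearMap
    (modelDeriv (I.prod 𝓘(ℝ, E →L[ℝ] ℝ)) (I.prod 𝓘(ℝ, E →L[ℝ] ℝ)) (cotangentOfMomentum I G) n))
    (canonicalTwoForm_eq_formPullback hz)

end CanonicalForm

section ChartLagrangian
variable {E : Type*} [NormedAddCommGroup E] [NormedSpace ℝ E]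
  {H : Type*} [TopologicalSpace H] {I : ModelWithCorners ℝ E H}
  {G : Type*} [TopologicalSpace G] [ChartedSpace H G] [Group G] [LieGroup I ∞ G]

/-- The left-trivialized Lagrangian `ℓ` in the preferred chart at `g₀`. -/
def chartLagrangian (L : Lagrangian I G) (g₀ : G) (z : E × E) : ℝ :=
  leftLagrangian L ((extChartAt I g₀).symm z.1) z.2

variable (I) in
/-- A function of `(g, μ)` in the preferred chart at `g₀`, used for the velocity `ξ = X (g, μ)`. -/
def chartVelocity (X : G × (E →L[ℝ] ℝ) → E) (g₀ : G) (y : E × (E →L[ℝ] ℝ)) : E :=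
  X ((extChartAt I g₀).symm y.1, y.2)

variable [I.Boundaryless]

theorem contDiffAt_comp_extChartAt_symm_prod {V W : Type*} [NormedAddCommGroup V] [NormedSpace ℝ V]
    [NormedAddCommGroup W] [NormedSpace ℝ W] {f : G × V → W}
    (hf : ContMDiff (I.prod 𝓘(ℝ, V)) 𝓘(ℝ, W) ∞ f) {g₀ : G} {z : E × V}
    (hz : z.1 ∈ (extChartAt I g₀).target) :
    ContDiffAt ℝ ∞ (fun z : E × V => f ((extChartAt I g₀).symm z.1, z.2)) z := by
  have hchart : ContMDiffAt 𝓘(ℝ, E × V) (I.prod 𝓘(ℝ, V)) ∞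
      (fun z : E × V => ((extChartAt I g₀).symm z.1, z.2)) z :=
    ((contMDiffAt_extChartAt_symm hz).comp z contDiff_fst.contMDiff.contMDiffAt).prodMk
      contDiff_snd.contMDiff.contMDiffAt
  exact (hf.contMDiffAt.comp z hchart).contDiffAt

theorem contDiffAt_chartLagrangian (L : Lagrangian I G) {g₀ : G} {z : E × E}
    (hz : z.1 ∈ (extChartAt I g₀).target) : ContDiffAt ℝ ∞ (chartLagrangian L g₀) z :=
  contDiffAt_comp_extChartAt_symm_prod (contMDiff_leftLagrangian L) hz

theorem hasFDerivAt_chartLagrangian (L : Lagrangian I G) {g₀ : G} {z : E × E}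
    (hz : z.1 ∈ (extChartAt I g₀).target) :
    HasFDerivAt (chartLagrangian L g₀) (fderiv ℝ (chartLagrangian L g₀) z) z :=
  ((contDiffAt_chartLagrangian L hz).differentiableAt (by simp)).hasFDerivAt

theorem IsLegendreInverse.contDiffAt_chartVelocity {L : Lagrangian I G}
    {X : G × (E →L[ℝ] ℝ) → E} (hX : IsLegendreInverse L X) {g₀ : G} {y : E × (E →L[ℝ] ℝ)}
    (hy : y.1 ∈ (extChartAt I g₀).target) : ContDiffAt ℝ ∞ (chartVelocity I X g₀) y :=
  contDiffAt_comp_extChartAt_symm_prod hX.contMDiff hy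

theorem fderiv_chartLagrangian_inr (L : Lagrangian I G) {g₀ : G} {z : E × E}
    (hz : z.1 ∈ (extChartAt I g₀).target) (η : E) :
    fderiv ℝ (chartLagrangian L g₀) z (0, η) =
      dLagrangian_dξ L ((extChartAt I g₀).symm z.1) z.2 η := by
  have hpartial : HasFDerivAt (fun ζ : E => chartLagrangian L g₀ (z.1, ζ)) _ z.2 :=
    HasFDerivAt.comp (g := chartLagrangian L g₀) z.2 (hasFDerivAt_chartLagrangian L hz)
      (hasFDerivAt_prodMk_right z.1 z.2)
  exact (DFunLike.congr_fun hpartial.fderiv η).symm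

theorem dLagrangian_dg_leftMul (L : Lagrangian I G) {g₀ g : G}
    (hg : g ∈ (extChartAt I g₀).source) (ξ η : E) :
    dLagrangian_dg L g ξ (leftMul I g η) = fderiv ℝ (chartLagrangian L g₀) (extChartAt I g₀ g, ξ)
      (leftFrame I g₀ (extChartAt I g₀ g) η, 0) := by
  have : IsManifold I 1 G := IsManifold.of_le (n := ∞) (by simp)
  have hpartial : HasFDerivAt (fun q : E => chartLagrangian L g₀ (q, ξ)) _ (extChartAt I g₀ g) :=
    HasFDerivAt.comp (g := chartLagrangian L g₀) _
      (hasFDerivAt_chartLagrangian L (z := (extChartAt I g₀ g, ξ))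
        ((extChartAt I g₀).map_source hg)) (hasFDerivAt_prodMk_left (extChartAt I g₀ g) ξ)
  have hchain := modelDeriv_comp hpartial.differentiableAt.mdifferentiableAt
    (mdifferentiableAt_extChartAt_of_mem_source hg)
  rw [modelDeriv_eq_fderiv, hpartial.fderiv] at hchain
  have hlocal : (fun h : G => leftLagrangian L h ξ) =ᶠ[𝓝 g]
      (fun q : E => chartLagrangian L g₀ (q, ξ)) ∘ extChartAt I g₀ := by
    filter_upwards [(isOpen_extChartAt_source (I := I) g₀).mem_nhds hg] with h hh
    rw [Function.comp_apply, chartLagrangian, (extChartAt I g₀).left_inv hh]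
  rw [leftFrame_extChartAt hg]
  exact congrArg (fun A : E →L[ℝ] ℝ => A (leftMul I g η)) ((modelDeriv_congr hlocal).trans hchain)

end ChartLagrangian

section HPField
variable {E : Type*} [NormedAddCommGroup E] [NormedSpace ℝ E] [FiniteDimensional ℝ E]
  {H : Type*} [TopologicalSpace H] {I : ModelWithCorners ℝ E H}
  {G : Type*} [TopologicalSpace G] [ChartedSpace H G] [Group G] [LieGroup I ∞ G]

variable (I G) in
theorem contDiff_coad :
    ContDiff ℝ ∞ (F := E →L[ℝ] ℝ) fun p : E × (E →L[ℝ] ℝ) => coad (I := I) (G := G) p.1 p.2 := by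
  have : CompleteSpace E := FiniteDimensional.complete ℝ E
  have : LieGroup I (minSmoothness ℝ 3) G := by
    rw [minSmoothness_of_isRCLikeNormedField]
    infer_instance
  refine (contDiff_clm_apply_iff (E := E)).2 fun η => ?_
  let adη : E →ₗ[ℝ] E := LieAlgebra.ad ℝ (GroupLieAlgebra I G) η
  have hpairing : ContDiff ℝ ∞ fun p : E × (E →L[ℝ] ℝ) =>
      -p.2 (LinearMap.toContinuousLinearMap adη p.1) :=
    (contDiff_snd.clm_apply ((ContinuousLinearMap.contDiff _).comp contDiff_fst)).neg
  have hcoad : (fun p : E × (E →L[ℝ] ℝ) => coad (I := I) (G := G) p.1 p.2 η) =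
      fun p => -p.2 (LinearMap.toContinuousLinearMap adη p.1) := funext fun p =>
    (congrArg p.2 (lie_skew (L := GroupLieAlgebra I G) p.1 η).symm).trans (map_neg p.2 _)
  exact hcoad ▸ hpairing

/-- The left-trivialized Hamilton–Pontryagin equations in the variables `(g, μ)`, with the velocity
`ξ = X (g, μ)` eliminated, as a vector field on `G × 𝔤*`. -/
def hpField (L : Lagrangian I G) (X : G × (E →L[ℝ] ℝ) → E) (n : G × (E →L[ℝ] ℝ)) :
    TangentSpace (I.prod 𝓘(ℝ, E →L[ℝ] ℝ)) n :=
  ((leftMul I n.1 (X n), coad (I := I) (G := G) (X n) n.2 +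
    (dLagrangian_dg L n.1 (X n)).comp (leftMul I n.1)) : E × (E →L[ℝ] ℝ))

/-- The momentum component of `hpField` in the preferred chart at `g₀`. -/
def chartForce (L : Lagrangian I G) (X : G × (E →L[ℝ] ℝ) → E) (g₀ : G)
    (y : E × (E →L[ℝ] ℝ)) : E →L[ℝ] ℝ :=
  let coadTerm : E →L[ℝ] ℝ := coad (I := I) (G := G) (chartVelocity (E := E) I X g₀ y) y.2
  coadTerm + ((fderiv ℝ (chartLagrangian L g₀) (y.1, chartVelocity I X g₀ y)).comp
      (ContinuousLinearMap.inl ℝ E E)).comp (leftFrame I g₀ y.1)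

variable [I.Boundaryless]

theorem chartField_hpField (L : Lagrangian I G) (X : G × (E →L[ℝ] ℝ) → E)
    {n₀ : G × (E →L[ℝ] ℝ)} {y : E × (E →L[ℝ] ℝ)} (hy : y.1 ∈ (extChartAt I n₀.1).target) :
    chartField (hpField L X) n₀ y =
      (leftFrame I n₀.1 y.1 (chartVelocity I X n₀.1 y), chartForce L X n₀.1 y) := by
  have : IsManifold I 1 G := IsManifold.of_le (n := ∞) (by simp)
  have hg := (extChartAt I n₀.1).map_target hy
  refine (modelDeriv_extChartAt_prod_modelSpace (n₀ := n₀)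
    (n := ((extChartAt I n₀.1).symm y.1, y.2)) hg (hpField L X _)).trans ?_
  refine Prod.ext rfl (ContinuousLinearMap.ext fun η => ?_)
  have hforce := dLagrangian_dg_leftMul L hg (chartVelocity I X n₀.1 y) η
  rw [(extChartAt I n₀.1).right_inv hy] at hforce
  exact congrArg (fun r : ℝ =>
    coad (I := I) (G := G) (chartVelocity (E := E) I X n₀.1 y) y.2 η + r) hforce

namespace IsLegendreInverse
variable {L : Lagrangian I G} {X : G × (E →L[ℝ] ℝ) → E}

theorem contDiffAt_chartForce (hX : IsLegendreInverse L X) {g₀ : G} {y : E × (E →L[ℝ] ℝ)}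
    (hy : y.1 ∈ (extChartAt I g₀).target) : ContDiffAt ℝ ∞ (chartForce L X g₀) y := by
  have hξ := hX.contDiffAt_chartVelocity hy
  have hframe : ContDiffAt ℝ ∞ (fun y : E × (E →L[ℝ] ℝ) => leftFrame I g₀ y.1) y :=
    ContDiffAt.comp y ((contDiffOn_leftFrame g₀).contDiffAt
      ((isOpen_extChartAt_target g₀).mem_nhds hy)) contDiffAt_fst
  have hdℓ : ContDiffAt ℝ ∞ (fun y : E × (E →L[ℝ] ℝ) =>
      fderiv ℝ (chartLagrangian L g₀) (y.1, chartVelocity I X g₀ y)) y :=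
    ContDiffAt.comp (g := fderiv ℝ (chartLagrangian L g₀)) y
      ((contDiffAt_chartLagrangian L (z := (y.1, chartVelocity I X g₀ y)) hy).fderiv_right
        (m := ∞) (by simp)) (contDiffAt_fst.prodMk hξ)
  exact ((contDiff_coad I G).contDiffAt.comp y (hξ.prodMk contDiffAt_snd)).add
    ((hdℓ.clm_comp contDiffAt_const).clm_comp hframe)

theorem contMDiff_hpField (hX : IsLegendreInverse L X) :
    ContMDiff (I.prod 𝓘(ℝ, E →L[ℝ] ℝ)) (I.prod 𝓘(ℝ, E →L[ℝ] ℝ)).tangent ∞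
      (fun n => (⟨n, hpField L X n⟩ : TangentBundle (I.prod 𝓘(ℝ, E →L[ℝ] ℝ)) _)) := by
  refine contMDiff_iff_contDiffOn_chartField.2 fun n₀ => ?_
  rw [extChartAt_prod_modelSpace_target]
  refine ContDiffOn.congr (fun y hy => ContDiffAt.contDiffWithinAt ?_)
    fun y hy => chartField_hpField L X hy.1
  have hframe : ContDiffAt ℝ ∞ (fun y : E × (E →L[ℝ] ℝ) => leftFrame I n₀.1 y.1) y :=
    ContDiffAt.comp y ((contDiffOn_leftFrame n₀.1).contDiffAt
      ((isOpen_extChartAt_target n₀.1).mem_nhds hy.1)) contDiffAt_fst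
  exact (hframe.clm_apply (hX.contDiffAt_chartVelocity hy.1)).prodMk
    (hX.contDiffAt_chartForce hy.1)

theorem lieDerivOneForm_chartField_hpField (hX : IsLegendreInverse L X) {n₀ : G × (E →L[ℝ] ℝ)}
    {y : E × (E →L[ℝ] ℝ)} (hy : y.1 ∈ (extChartAt I n₀.1).target) :
    lieDerivOneForm (chartField (hpField L X) n₀) (momentumOneForm I n₀.1) y =
      fderiv ℝ (fun z => chartLagrangian L n₀.1 (z.1, chartVelocity I X n₀.1 z)) y := by
  let ξ := chartVelocity I X n₀.1
  have hξ : DifferentiableAt ℝ ξ y := (hX.contDiffAt_chartVelocity hy).differentiableAt (by simp)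
  have hlocal : chartField (hpField L X) n₀ =ᶠ[𝓝 y]
      fun z => (leftFrame I n₀.1 z.1 (ξ z), chartForce L X n₀.1 z) := by
    filter_upwards [((isOpen_extChartAt_target (I := I) n₀.1).preimage
      continuous_fst).mem_nhds hy] with z hz using chartField_hpField L X hz
  have hℓ : HasFDerivAt (fun z : E × (E →L[ℝ] ℝ) => chartLagrangian L n₀.1 (z.1, ξ z)) _ y :=
    HasFDerivAt.comp (g := chartLagrangian L n₀.1) y
      (hasFDerivAt_chartLagrangian L (z := (y.1, ξ y)) hy) (hasFDerivAt_fst.prodMk hξ.hasFDerivAt)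
  refine ContinuousLinearMap.ext fun ⟨w, ν⟩ => ?_
  obtain ⟨η, rfl⟩ : ∃ η, leftFrame I n₀.1 y.1 η = w := ⟨_, leftFrame_leftCoframe hy w⟩
  have hlegendre : fderiv ℝ (chartLagrangian L n₀.1) (y.1, ξ y)
      (0, fderiv ℝ ξ y (leftFrame I n₀.1 y.1 η, ν)) =
        y.2 (fderiv ℝ ξ y (leftFrame I n₀.1 y.1 η, ν)) :=
    (fderiv_chartLagrangian_inr L (z := (y.1, ξ y)) hy _).trans
      (DFunLike.congr_fun (hX.right_inv ((extChartAt I n₀.1).symm y.1, y.2)) _)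
  have hsplit : fderiv ℝ (fun z => chartLagrangian L n₀.1 (z.1, ξ z)) y
      (leftFrame I n₀.1 y.1 η, ν) =
        fderiv ℝ (chartLagrangian L n₀.1) (y.1, ξ y) (leftFrame I n₀.1 y.1 η, 0) +
          y.2 (fderiv ℝ ξ y (leftFrame I n₀.1 y.1 η, ν)) := by
    rw [← hlegendre, ← map_add, Prod.mk_add_mk, add_zero, zero_add]
    exact DFunLike.congr_fun hℓ.fderiv _
  have hforce : chartForce L X n₀.1 y η = coad (I := I) (G := G) (ξ y) y.2 η +
      fderiv ℝ (chartLagrangian L n₀.1) (y.1, ξ y) (leftFrame I n₀.1 y.1 η, 0) := rfl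
  rw [lieDerivOneForm_congr hlocal, lieDerivOneForm_momentumOneForm hy hξ
    ((hX.contDiffAt_chartForce hy).differentiableAt (by simp)), hsplit, hforce]
  ring

theorem hasInvariantPrimitives (hX : IsLegendreInverse L X) :
    HasInvariantPrimitives (hpField L X) (momentumTwoForm I G) := by
  have htwo : (2 : WithTop ℕ∞) ≤ ∞ := WithTop.coe_le_coe.2 le_top
  intro n₀
  refine ⟨momentumOneForm I n₀.1, fun z => chartLagrangian L n₀.1 (z.1, chartVelocity I X n₀.1 z),
    ?_, ?_, ?_, ?_⟩
  · rw [extChartAt_prod_modelSpace_target]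
    exact (contDiffOn_momentumOneForm n₀.1).of_le htwo
  · rw [extChartAt_prod_modelSpace_target]
    intro y hy
    exact ((ContDiffAt.comp (g := chartLagrangian L n₀.1) y
      (contDiffAt_chartLagrangian L (z := (y.1, chartVelocity I X n₀.1 y)) hy.1)
      (contDiffAt_fst.prodMk (hX.contDiffAt_chartVelocity hy.1))).of_le htwo).contDiffWithinAt
  · rw [extChartAt_prod_modelSpace_target]
    exact fun y hy => hX.lieDerivOneForm_chartField_hpField hy.1
  · rw [extChartAt_prod_modelSpace_source]
    exact fun n hn => momentumTwoForm_eq_formPullback hn.1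

end IsLegendreInverse

end HPField

section AdmissibleSpace
variable {E : Type*} [NormedAddCommGroup E] [NormedSpace ℝ E]
  {H : Type*} [TopologicalSpace H] {I : ModelWithCorners ℝ E H}
  {G : Type*} [TopologicalSpace G] [ChartedSpace H G] [Group G] [LieGroup I ∞ G]

/-- The projection `(g, ξ, μ) ↦ (g, μ)` of the left-trivialized admissible space. -/
def admissibleMomentum (L : Lagrangian I G) (x : admissibleLeft L) : G × (E →L[ℝ] ℝ) :=
  (x.1.1, x.1.2.2)

/-- The map `(g, μ) ↦ (g, ξ, ∂ℓ/∂ξ (g, ξ))` with `ξ = X (g, μ)`; it inverts `admissibleMomentum`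
when `X` inverts the Legendre transform. -/
def admissibleOfMomentum (L : Lagrangian I G) (X : G × (E →L[ℝ] ℝ) → E)
    (n : G × (E →L[ℝ] ℝ)) : admissibleLeft L :=
  (admissibleLeftHomeo L).symm (n.1, X n)

theorem contMDiff_admissibleMomentum (L : Lagrangian I G) :
    ContMDiff (I.prod 𝓘(ℝ, E)) (I.prod 𝓘(ℝ, E →L[ℝ] ℝ)) ∞ (admissibleMomentum L) :=
  (contMDiff_admissibleLeft_val L).fst.prodMk (contMDiff_admissibleLeft_val L).snd.snd

theorem symplecticFormLeft_eq_formPullback (L : Lagrangian I G) :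
    symplecticFormLeft L = formPullback (I.prod 𝓘(ℝ, E)) (I.prod 𝓘(ℝ, E →L[ℝ] ℝ))
      (admissibleMomentum L) (momentumTwoForm I G) := by
  funext x
  have hφ : MDifferentiableAt (I.prod 𝓘(ℝ, E)) I.tangent (leftTrivializationRestr L) x :=
    (contMDiff_leftTrivializationRestr L).mdifferentiableAt (by simp)
  have hπ : MDifferentiableAt I.tangent (I.prod 𝓘(ℝ, E →L[ℝ] ℝ)) (piHPRestr L)
      (leftTrivializationRestr L x) :=
    (contMDiff_piHP.comp (contMDiff_admissibleHP_val L)).mdifferentiableAt (by simp)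
  have hcotangent : MDifferentiableAt (I.prod 𝓘(ℝ, E →L[ℝ] ℝ)) (I.prod 𝓘(ℝ, E →L[ℝ] ℝ))
      (cotangentOfMomentum I G) (admissibleMomentum L x) :=
    contMDiff_cotangentOfMomentum.mdifferentiableAt (by simp)
  have hmomentum : MDifferentiableAt (I.prod 𝓘(ℝ, E)) (I.prod 𝓘(ℝ, E →L[ℝ] ℝ))
      (admissibleMomentum L) x := (contMDiff_admissibleMomentum L).mdifferentiableAt (by simp)
  exact (formPullback_comp (canonicalTwoForm I G) hπ hφ).symm.trans
    (formPullback_comp (canonicalTwoForm I G) hcotangent hmomentum)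

namespace IsLegendreInverse
variable {L : Lagrangian I G} {X : G × (E →L[ℝ] ℝ) → E}

theorem admissibleMomentum_admissibleOfMomentum (hX : IsLegendreInverse L X)
    (n : G × (E →L[ℝ] ℝ)) : admissibleMomentum L (admissibleOfMomentum L X n) = n :=
  Prod.ext rfl (hX.right_inv n)

theorem velocity_admissibleMomentum (hX : IsLegendreInverse L X) (x : admissibleLeft L) :
    X (admissibleMomentum L x) = x.1.2.1 := by
  have hx : x.1.2.2 = dLagrangian_dξ L x.1.1 x.1.2.1 := x.2
  rw [admissibleMomentum, hx, hX.left_inv]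

theorem injective_admissibleMomentum (hX : IsLegendreInverse L X) :
    Function.Injective (admissibleMomentum L) := by
  intro x y h
  obtain ⟨hg, hμ⟩ := Prod.ext_iff.1 h
  have hξ : x.1.2.1 = y.1.2.1 := (hX.velocity_admissibleMomentum x).symm.trans
    ((congrArg X h).trans (hX.velocity_admissibleMomentum y))
  exact Subtype.ext (Prod.ext hg (Prod.ext hξ hμ))

theorem contMDiff_admissibleOfMomentum (hX : IsLegendreInverse L X) :
    ContMDiff (I.prod 𝓘(ℝ, E →L[ℝ] ℝ)) (I.prod 𝓘(ℝ, E)) ∞ (admissibleOfMomentum L X) :=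
  (contMDiff_transported_symm (I := I.prod 𝓘(ℝ, E)) (admissibleLeftHomeo L)).comp
    (contMDiff_fst.prodMk hX.contMDiff)

end IsLegendreInverse

end AdmissibleSpace

section Solutions
variable {E : Type*} [NormedAddCommGroup E] [NormedSpace ℝ E] [FiniteDimensional ℝ E]
  {H : Type*} [TopologicalSpace H] {I : ModelWithCorners ℝ E H}
  {G : Type*} [TopologicalSpace G] [ChartedSpace H G] [Group G] [LieGroup I ∞ G]
  {L : Lagrangian I G} {X : G × (E →L[ℝ] ℝ) → E} {a b : ℝ}

namespace IsLegendreInverse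

theorem isMIntegralCurveOn_hpField (hX : IsLegendreInverse L X) {g : ℝ → G} {ξ : ℝ → E}
    {μ : ℝ → E →L[ℝ] ℝ} (h : IsHPSolution L a b g ξ μ) :
    IsMIntegralCurveOn (fun t => (g t, μ t)) (hpField L X) (Icc a b) := by
  intro t ht
  have hξ : X (g t, μ t) = ξ t := by rw [h.legendre t ht, hX.left_inv]
  have hg := h.reconstruction t ht
  have hμ := (h.momentum t ht).hasFDerivWithinAt.hasMFDerivWithinAt
  rw [← hξ] at hg hμ
  have hpair (u : E) (ν : E →L[ℝ] ℝ) : ((1 : ℝ →L[ℝ] ℝ).smulRight u).prod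
      (ContinuousLinearMap.toSpanSingleton ℝ ν) = (1 : ℝ →L[ℝ] ℝ).smulRight (u, ν) := by
    ext <;> simp
  exact (hg.prodMk hμ).congr_mfderiv (hpair _ _)

theorem isHPSolution (hX : IsLegendreInverse L X) {γ : ℝ → G × (E →L[ℝ] ℝ)}
    (h : IsMIntegralCurveOn γ (hpField L X) (Icc a b)) :
    IsHPSolution L a b (fun t => (γ t).1) (fun t => X (γ t)) (fun t => (γ t).2) where
  reconstruction t ht := by
    have hfst (u : E) (ν : E →L[ℝ] ℝ) : (ContinuousLinearMap.fst ℝ E (E →L[ℝ] ℝ)).comp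
        ((1 : ℝ →L[ℝ] ℝ).smulRight (u, ν)) = (1 : ℝ →L[ℝ] ℝ).smulRight u := by
      ext
      simp
    exact ((hasMFDerivAt_fst (I := I) (I' := 𝓘(ℝ, E →L[ℝ] ℝ)) (γ t)).comp_hasMFDerivWithinAt t
      (h t ht)).congr_mfderiv (hfst _ _)
  momentum t ht := by
    have hsnd (u : E) (ν : E →L[ℝ] ℝ) : (ContinuousLinearMap.snd ℝ E (E →L[ℝ] ℝ)).comp
        ((1 : ℝ →L[ℝ] ℝ).smulRight (u, ν)) = ContinuousLinearMap.toSpanSingleton ℝ ν := by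
      ext
      simp
    exact hasDerivWithinAt_iff_hasFDerivWithinAt.2
      (((hasMFDerivAt_snd (I := I) (I' := 𝓘(ℝ, E →L[ℝ] ℝ)) (γ t)).comp_hasMFDerivWithinAt t
        (h t ht)).congr_mfderiv (hsnd _ _)).hasFDerivWithinAt
  legendre t _ := (hX.right_inv (γ t)).symm

theorem hpConnects_iff_flowRel (hX : IsLegendreInverse L X) {x y : admissibleLeft L} :
    HPConnects L a b x y ↔
      FlowRel (hpField L X) (b - a) (admissibleMomentum L x) (admissibleMomentum L y) := by
  constructor
  · rintro ⟨g, ξ, μ, h, hx, hy⟩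
    refine ⟨fun t => (g (t + a), μ (t + a)), ?_, ?_, ?_⟩
    · simp only [zero_add, admissibleMomentum, ← hx]
    · simp only [sub_add_cancel, admissibleMomentum, ← hy]
    · exact (isMIntegralCurveOn_comp_add (dt := a).2 (hX.isMIntegralCurveOn_hpField h)).mono
        fun t ht => ⟨by linarith [ht.1], by linarith [ht.2]⟩
  · rintro ⟨γ, hx, hy, h⟩
    have hshift : IsMIntegralCurveOn (γ ∘ (· - a)) (hpField L X) (Icc a b) :=
      (isMIntegralCurveOn_comp_sub (dt := a).2 h).mono fun t ht =>
        ⟨by linarith [ht.1], by linarith [ht.2]⟩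
    have hval (z : admissibleLeft L) : ((admissibleMomentum L z).1, X (admissibleMomentum L z),
        (admissibleMomentum L z).2) = z.1 :=
      Prod.ext rfl (Prod.ext (hX.velocity_admissibleMomentum z) rfl)
    refine ⟨_, _, _, hX.isHPSolution hshift, ?_, ?_⟩
    · simp only [Function.comp_apply, sub_self, hx, hval]
    · simp only [Function.comp_apply, hy, hval]

variable [I.Boundaryless] [T2Space G]

theorem hpConnects_unique (hX : IsLegendreInverse L X) (hab : a ≤ b) {x y y' : admissibleLeft L}
    (h : HPConnects L a b x y) (h' : HPConnects L a b x y') : y = y' :=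
  have : CompleteSpace E := FiniteDimensional.complete ℝ E
  hX.injective_admissibleMomentum (FlowRel.unique hX.contMDiff_hpField (sub_nonneg.2 hab)
    (hX.hpConnects_iff_flowRel.1 h) (hX.hpConnects_iff_flowRel.1 h'))

theorem flowMap_eq_of_hpConnects (hX : IsLegendreInverse L X) (hab : a ≤ b)
    {x y : admissibleLeft L} (h : HPConnects L a b x y) : flowMap L a b x = y := by
  have hex : ∃ y, HPConnects L a b x y := ⟨y, h⟩
  rw [flowMap, dif_pos hex]
  exact hX.hpConnects_unique hab hex.choose_spec h

theorem exists_local_hpFlow (hX : IsLegendreInverse L X) (hab : a ≤ b) {x : admissibleLeft L}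
    (hx : x ∈ flowDomain L a b) :
    ∃ F : admissibleLeft L → admissibleLeft L, (∀ᶠ z in 𝓝 x, HPConnects L a b z (F z)) ∧
      MDifferentiableAt (I.prod 𝓘(ℝ, E)) (I.prod 𝓘(ℝ, E)) F x ∧
      formPullback (I.prod 𝓘(ℝ, E)) (I.prod 𝓘(ℝ, E)) F (symplecticFormLeft L) x =
        symplecticFormLeft L x := by
  have : CompleteSpace E := FiniteDimensional.complete ℝ E
  obtain ⟨y, hxy⟩ := hx
  obtain ⟨Φ, hΦ, hdiff, hform⟩ := FlowRel.flowPreservesAt hX.contMDiff_hpField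
    hX.hasInvariantPrimitives (sub_nonneg.2 hab) (hX.hpConnects_iff_flowRel.1 hxy)
  have hm (z : admissibleLeft L) : MDifferentiableAt (I.prod 𝓘(ℝ, E)) (I.prod 𝓘(ℝ, E →L[ℝ] ℝ))
      (admissibleMomentum L) z := (contMDiff_admissibleMomentum L).mdifferentiableAt (by simp)
  have hF : MDifferentiableAt (I.prod 𝓘(ℝ, E)) (I.prod 𝓘(ℝ, E))
      (admissibleOfMomentum L X ∘ Φ ∘ admissibleMomentum L) x :=
    (hX.contMDiff_admissibleOfMomentum.mdifferentiableAt (by simp)).comp x (hdiff.comp x (hm x))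
  have hsemiconj : admissibleMomentum L ∘ admissibleOfMomentum L X ∘ Φ ∘ admissibleMomentum L =
      Φ ∘ admissibleMomentum L :=
    funext fun _ => hX.admissibleMomentum_admissibleOfMomentum _
  refine ⟨admissibleOfMomentum L X ∘ Φ ∘ admissibleMomentum L, ?_, hF, ?_⟩
  · filter_upwards [(contMDiff_admissibleMomentum L).continuous.continuousAt.eventually hΦ]
      with z hz
    rw [hX.hpConnects_iff_flowRel]
    exact (hX.admissibleMomentum_admissibleOfMomentum _).symm ▸ hz
  · rw [symplecticFormLeft_eq_formPullback]
    exact formPullback_formPullback_eq_of_semiconj (.of_eq hsemiconj) hF (hm _) (hm x) hdiff hform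

end IsLegendreInverse

end Solutions

end
end HPFlow

theorem mainTheorem2
    {E : Type*} [NormedAddCommGroup E] [NormedSpace ℝ E] [FiniteDimensional ℝ E]
    {H : Type*} [TopologicalSpace H] (I : ModelWithCorners ℝ E H) [I.Boundaryless]
    {G : Type*} [TopologicalSpace G] [T2Space G] [ChartedSpace H G] [Group G] [LieGroup I ∞ G]
    (L : Lagrangian I G) (hL : Hyperregular L) (a b : ℝ) (hab : a ≤ b) :
    (∀ x y : admissibleLeft L, HPConnects L a b x y → flowMap L a b x = y) ∧
    IsOpen (flowDomain L a b) ∧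
    ∀ x ∈ flowDomain L a b,
      MDifferentiableAt (I.prod 𝓘(ℝ, E)) (I.prod 𝓘(ℝ, E)) (flowMap L a b) x ∧
      formPullback (I.prod 𝓘(ℝ, E)) (I.prod 𝓘(ℝ, E)) (flowMap L a b) (symplecticFormLeft L) x =
        symplecticFormLeft L x := by
  obtain ⟨X, hX⟩ := hL.exists_isLegendreInverse
  refine ⟨fun x y => hX.flowMap_eq_of_hpConnects hab, isOpen_iff_mem_nhds.2 fun x hx => ?_,
    fun x hx => ?_⟩
  · obtain ⟨F, hconnects, -, -⟩ := hX.exists_local_hpFlow hab hx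
    filter_upwards [hconnects] with z hz using ⟨F z, hz⟩
  · obtain ⟨F, hconnects, hdiff, hform⟩ := hX.exists_local_hpFlow hab hx
    have hF : flowMap L a b =ᶠ[nhds x] F := by
      filter_upwards [hconnects] with z hz using hX.flowMap_eq_of_hpConnects hab hz
    exact ⟨hdiff.congr_of_eventuallyEq hF, (formPullback_congr _ hF).trans hform⟩
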